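/- Let $n\ge 59$ be an integer. All graphs are finite and simple, and the spectral radius of a graph is that of its adjacency matrix. Let $\mathcal G(n,n-3)$ be the set of graphs that attain the maximum spectral radius among all connected nonregular graphs of order $n$ with maximum degree $n-3$. For even $t$, let $K_t-M_{t/2}$ denote the complete graph on $t$ vertices with the edges of a perfect matching deleted. For even $n$, let $H_1(n)$ be the graph whose vertex set is partitioned as $\{u,v\}\cup V_1\cup V_2$ with $|V_1|=n-4$, $|V_2|=2$, where $V_1$ induces $K_{n-4}-M_{(n-4)/2}$, $V_2$ induces $K_2$, and the remaining edges are $uv$, all edges between $v$ and $V_1$, and all edges between $V_1$ and $V_2$. For odd $n$, let $H_2(n)$ be the graph whose vertex set is partitioned as $\{u,v_1,v_2\}\cup V_1\cup V_2\cup V_3$ with $|V_1|=|V_2|=2$, $|V_3|=n-7$, where $\{u,v_1,v_2\}$ induces $K_3$, $V_1\cup V_2$ induces $K_4$, $V_3$ induces $K_{n-7}-M_{(n-7)/2}$, and the remaining edges are all edges between $V_3$ and $\{v_1,v_2\}\cup V_1\cup V_2$, all edges between $v_1$ and $V_1$, and all edges between $v_2$ and $V_2$. If $n$ is even, then a graph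 $G$ belongs to $\mathcal G(n,n-3)$ if and only if $G\cong H_1(n)$; if $n$ is odd, then $G$ belongs to $\mathcal G(n,n-3)$ if and only if $G\cong H_2(n)$. In particular, for each $n\ge 59$ the extremal graph exists and is unique up to isomorphism, and with $\Delta=n-3$ its degree sequence is $(\Delta,\ldots,\Delta,\delta)$ with $n-1$ entries $\Delta$, where $\delta=1$ if $n$ is even and $\delta=2$ if $n$ is odd. -/

import Mathlib

/-- The spectral radius `ρ(G)` of a finite graph: the spectral radius (largest modulus of a complex
eigenvalue) of its adjacency matrix. It is a finite element of `[0, ∞]`. -/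
noncomputable def graphSpectralRadius {V : Type*} [Fintype V] (G : SimpleGraph V) : ENNReal := by
  classical exact spectralRadius ℂ (G.adjMatrix ℂ)

open Classical in
/-- `G` is a connected nonregular graph of order `n` with maximum degree `Δ`. -/
structure IsConnectedNonregular {V : Type*} [Fintype V] (n Δ : ℕ) (G : SimpleGraph V) : Prop where
  order : Fintype.card V = n
  connected : G.Connected
  nonregular : ¬ ∃ d, G.IsRegularOfDegree d
  maxDegree : G.maxDegree = Δ

/-- `G ∈ 𝒢(n, Δ)`: the graph `G` attains the maximum spectral radius among all connected nonregular
graphs of order `n` with maximum degree `Δ`. Up to isomorphism, the graphs of order `n` are the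
graphs on the vertex set `Fin n`. -/
structure IsExtremal {V : Type*} [Fintype V] (n Δ : ℕ) (G : SimpleGraph V) : Prop where
  mem : IsConnectedNonregular n Δ G
  max : ∀ H : SimpleGraph (Fin n), IsConnectedNonregular n Δ H →
    graphSpectralRadius H ≤ graphSpectralRadius G

open Classical in
/-- The degree sequence of `G`, as a multiset. -/
noncomputable def degreeSeq {V : Type*} [Fintype V] (G : SimpleGraph V) : Multiset ℕ :=
  Finset.univ.val.map fun v => G.degree v

/-- For even `t`, the matching `M_{t/2}` on `Fin t`, with edges `{0,1}, {2,3}, …, {t-2,t-1}`. -/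
def pairMatching (t : ℕ) : SimpleGraph (Fin t) where
  Adj i j := i ≠ j ∧ i.val / 2 = j.val / 2
  symm := ⟨fun _ _ h => ⟨h.1.symm, h.2.symm⟩⟩
  loopless := ⟨fun _ h => h.1 rfl⟩

/-- For even `t`, the graph `K_t - M_{t/2}`. -/
def completeMinusMatching (t : ℕ) : SimpleGraph (Fin t) := ⊤ \ pairMatching t

/-- The vertices `{u, v} ∪ V₁ ∪ V₂` of `H₁(n)`, where `|V₁| = n - 4` and `|V₂| = 2`. -/
inductive H1Vertex (n : ℕ) : Type
  | u : H1Vertex n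
  | v : H1Vertex n
  | V1 (i : Fin (n - 4)) : H1Vertex n
  | V2 (i : Fin 2) : H1Vertex n

/-- The edges of `H₁(n)`; `SimpleGraph.fromRel` symmetrizes and removes loops. -/
def H1 (n : ℕ) : SimpleGraph (H1Vertex n) :=
  SimpleGraph.fromRel fun
    | .u, .v => True
    | .V1 i, .V1 j => (completeMinusMatching (n - 4)).Adj i j
    | .V2 _, .V2 _ => True
    | .v, .V1 _ => True
    | .V2 _, .V1 _ => True
    | _, _ => False

/-- The vertices `{u, v₁, v₂} ∪ V₁ ∪ V₂ ∪ V₃` of `H₂(n)`, where `|V₁| = |V₂| = 2` and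
`|V₃| = n - 7`. -/
inductive H2Vertex (n : ℕ) : Type
  | u : H2Vertex n
  | v1 : H2Vertex n
  | v2 : H2Vertex n
  | V1 (i : Fin 2) : H2Vertex n
  | V2 (i : Fin 2) : H2Vertex n
  | V3 (i : Fin (n - 7)) : H2Vertex n

/-- The edges of `H₂(n)`; `SimpleGraph.fromRel` symmetrizes and removes loops. -/
def H2 (n : ℕ) : SimpleGraph (H2Vertex n) :=
  SimpleGraph.fromRel fun
    | .u, .v1 => True
    | .u, .v2 => True
    | .v1, .v2 => True
    | .V1 _, .V1 _ => True
    | .V1 _, .V2 _ => True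
    | .V2 _, .V2 _ => True
    | .V3 i, .V3 j => (completeMinusMatching (n - 7)).Adj i j
    | .V3 _, .v1 => True
    | .V3 _, .v2 => True
    | .V3 _, .V1 _ => True
    | .V3 _, .V2 _ => True
    | .v1, .V1 _ => True
    | .v2, .V2 _ => True
    | _, _ => False

/-! Let ρ be the spectral radius of a competitor, e = n - 3 - ρ its gap, and u = 1/(ρ + 1). Scale a
nonnegative eigenvector x to total ρ + 3. Summing the eigenvalue equation over all vertices shows
that the defects, weighted by x, add up to e(ρ + 3) (`sum_defect`). Rewriting the equation at i
through the nonneighbors of i gives (ρ + 1) x_i = ρ + 3 - (sum of x over the nonneighbors)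
(`eq_coNeighbors`). A vertex of degree n - 3 has two nonneighbors, so its entry is close to 1. A
vertex of small degree d with d such neighbors has entry about d/ρ and defect about ρ, so it
contributes about d to the weighted sum.

Test vectors on `H1` and `H2` show that a competitor at least as good has gap at most about 1/n,
respectively 2/n - 4/n² - 8/n³. The weighted sum is then at most 2 - 4u + O(u²). This leaves room
for a single deficient vertex, of degree 1, of degree 2 or of defect 2 (`trichotomy`): every other
configuration loses less than 4u from the value 2, or exceeds 2 outright.

The handshake lemma excludes degree 2 for even n and degree 1 for odd n. For even n, defect 2 would
cost nearly 2 when only about 1 is available. For odd n, the rivals to `H2` are a vertex of defect 2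
and a vertex of degree 2 with nonadjacent neighbors; their gaps can be told from the test-vector
bound only in the n⁻³ term (`not_single_defect_two`, `adj_of_single_degree_two`).

Once the deficient vertex and its neighborhood are known, the complement is forced: every other
vertex misses exactly two vertices, and outside a few special ones one of these is the deficient
vertex, so the rest of the complement is a perfect matching (`nonempty_iso_h1`, `nonempty_iso_h2`).
-/

open Matrix

/-! ### The spectral radius as a real eigenvalue with a nonnegative eigenvector -/

section
-- With ρ the largest real eigenvalue, ρI - A is positive semidefinite. Taking absolute values of
-- the entries of an eigenvector does not decrease its quadratic form, so the vector of absolute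
-- values is in the kernel of ρI - A. The same device bounds the modulus of every complex eigenvalue
-- by ρ. Connectedness is not needed, as only nonnegativity is claimed.
open Classical in
theorem exists_perron {V : Type*} [Fintype V] [Nonempty V] (G : SimpleGraph V) :
    ∃ ρ : ℝ, 0 ≤ ρ ∧ graphSpectralRadius G = ENNReal.ofReal ρ ∧
      (∀ z : V → ℝ, z ⬝ᵥ (G.adjMatrix ℝ *ᵥ z) ≤ ρ * (z ⬝ᵥ z)) ∧
      ∃ x : V → ℝ, (∀ i, 0 ≤ x i) ∧ x ≠ 0 ∧ G.adjMatrix ℝ *ᵥ x = ρ • x := by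
  set A := G.adjMatrix ℝ with hA
  have hH : A.IsHermitian := by
    rw [Matrix.IsHermitian, conjTranspose_eq_transpose_of_trivial]
    exact SimpleGraph.transpose_adjMatrix G
  obtain ⟨k, -, hk⟩ := Finset.exists_max_image Finset.univ hH.eigenvalues Finset.univ_nonempty
  set ρ := hH.eigenvalues k with hρ
  have hpsd : (ρ • (1 : Matrix V V ℝ) - A).PosSemidef := by
    have hB : (ρ • (1 : Matrix V V ℝ) - A).IsHermitian := by
      refine Matrix.IsHermitian.sub ?_ hH
      rw [Matrix.IsHermitian, conjTranspose_smul, conjTranspose_one, star_trivial]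
    rw [hB.posSemidef_iff_eigenvalues_nonneg]
    intro i
    have h1 := hB.mulVec_eigenvectorBasis i
    rw [sub_mulVec, smul_mulVec, one_mulVec] at h1
    have h2 : A *ᵥ (hB.eigenvectorBasis i).ofLp =
        (ρ - hB.eigenvalues i) • (hB.eigenvectorBasis i).ofLp := by
      rw [sub_smul, ← h1, sub_sub_cancel]
    have h3 : ρ - hB.eigenvalues i ∈ spectrum ℝ A := by
      rw [← spectrum_toLin', ← Module.End.hasEigenvalue_iff_mem_spectrum]
      refine Module.End.hasEigenvalue_of_hasEigenvector (x := (hB.eigenvectorBasis i).ofLp) ?_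
      rw [Module.End.hasEigenvector_iff, Module.End.mem_eigenspace_iff]
      refine ⟨by rw [toLin'_apply, h2], fun h => hB.eigenvectorBasis.orthonormal.ne_zero i ?_⟩
      ext j
      exact congrFun h j
    rw [hH.spectrum_real_eq_range_eigenvalues] at h3
    obtain ⟨j, hj⟩ := h3
    have := hk j (Finset.mem_univ _)
    simp only [Pi.zero_apply]
    linarith
  have hpos : ∀ z : V → ℝ, z ⬝ᵥ (A *ᵥ z) ≤ ρ * (z ⬝ᵥ z) := by
    intro z
    have := hpsd.dotProduct_mulVec_nonneg z
    simp only [star_trivial, sub_mulVec, smul_mulVec, one_mulVec, dotProduct_sub, dotProduct_smul,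
      smul_eq_mul] at this
    linarith
  set y : V → ℝ := fun i => hH.eigenvectorBasis k i with hy
  have hye : A *ᵥ y = ρ • y := by
    have := hH.mulVec_eigenvectorBasis k
    exact this
  have hy0 : y ≠ 0 := by
    intro h
    have := hH.eigenvectorBasis.orthonormal.ne_zero k
    apply this
    ext i
    exact congrFun h i
  have hA0 : ∀ i j, 0 ≤ A i j := by
    intro i j
    simp only [hA, SimpleGraph.adjMatrix_apply]
    split_ifs <;> norm_num
  set x : V → ℝ := fun i => |y i| with hx
  have hxx : x ⬝ᵥ x = y ⬝ᵥ y := by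
    simp [dotProduct, hx]
  have hx0 : x ≠ 0 := by
    intro h
    apply hy0
    ext i
    simpa [hx] using congrFun h i
  have hxA : y ⬝ᵥ (A *ᵥ y) ≤ x ⬝ᵥ (A *ᵥ x) := by
    simp only [dotProduct, mulVec, Finset.mul_sum]
    refine Finset.sum_le_sum fun i _ => Finset.sum_le_sum fun j _ => ?_
    calc y i * (A i j * y j) ≤ |y i * (A i j * y j)| := le_abs_self _
      _ = _ := by rw [abs_mul, abs_mul, abs_of_nonneg (hA0 i j)]
  have hxe : A *ᵥ x = ρ • x := by
    have h0 : x ⬝ᵥ ((ρ • (1 : Matrix V V ℝ) - A) *ᵥ x) = 0 := by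
      apply le_antisymm
      · simp only [sub_mulVec, smul_mulVec, one_mulVec, dotProduct_sub, dotProduct_smul,
          smul_eq_mul]
        rw [hye, dotProduct_smul, smul_eq_mul] at hxA
        rw [hxx]
        linarith
      · simpa using hpsd.dotProduct_mulVec_nonneg x
    have := (hpsd.dotProduct_mulVec_zero_iff x).1 (by simpa using h0)
    rw [sub_mulVec, smul_mulVec, one_mulVec, sub_eq_zero] at this
    exact this.symm
  have hρ0 : 0 ≤ ρ := by
    obtain ⟨i, hi⟩ := Function.ne_iff.1 hx0
    have hi' : 0 < x i := lt_of_le_of_ne (abs_nonneg _) (Ne.symm hi)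
    have h1 := congrFun hxe i
    have h2 : 0 ≤ (A *ᵥ x) i := Finset.sum_nonneg fun j _ => mul_nonneg (hA0 i j) (abs_nonneg _)
    rw [h1] at h2
    simp only [Pi.smul_apply, smul_eq_mul] at h2
    by_contra h
    nlinarith
  refine ⟨ρ, hρ0, ?_, hpos, x, fun i => abs_nonneg _, hx0, hxe⟩
  have hgs : graphSpectralRadius G = spectralRadius ℂ (G.adjMatrix ℂ) := rfl
  have hAC : G.adjMatrix ℂ = A.map (fun t : ℝ => (t : ℂ)) := by
    ext i j
    simp only [hA, map_apply, SimpleGraph.adjMatrix_apply]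
    split_ifs <;> simp
  rw [hgs]
  apply le_antisymm
  · refine iSup₂_le fun μ hμ => ?_
    rw [← spectrum_toLin', ← Module.End.hasEigenvalue_iff_mem_spectrum] at hμ
    obtain ⟨z, hz⟩ := hμ.exists_hasEigenvector
    have hz1 : (G.adjMatrix ℂ) *ᵥ z = μ • z := by
      have := hz.apply_eq_smul
      rwa [toLin'_apply] at this
    set w : V → ℝ := fun i => ‖z i‖ with hw
    have hw0 : 0 < w ⬝ᵥ w := by
      obtain ⟨i, hi⟩ := Function.ne_iff.1 hz.2
      refine Finset.sum_pos' (fun i _ => mul_self_nonneg _) ⟨i, Finset.mem_univ _, ?_⟩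
      have : 0 < ‖z i‖ := norm_pos_iff.2 hi
      exact mul_pos this this
    have h1 : ‖μ‖ * (w ⬝ᵥ w) ≤ w ⬝ᵥ (A *ᵥ w) := by
      simp only [dotProduct, mulVec, Finset.mul_sum (s := Finset.univ) (a := ‖μ‖)]
      refine Finset.sum_le_sum fun i _ => ?_
      have h2 : ‖μ‖ * w i ≤ ∑ j, A i j * w j := by
        have := congrFun hz1 i
        simp only [Pi.smul_apply, smul_eq_mul] at this
        rw [hw, ← norm_mul, ← this]
        refine (norm_sum_le _ _).trans (Finset.sum_le_sum fun j _ => ?_)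
        have h5 : G.adjMatrix ℂ i j = (A i j : ℂ) := by rw [hAC, map_apply]
        simp only [norm_mul]
        rw [h5, Complex.norm_real, Real.norm_of_nonneg (hA0 i j)]
      have h3 : 0 ≤ w i := norm_nonneg _
      nlinarith
    have h4 : ‖μ‖ ≤ ρ := le_of_mul_le_mul_right (h1.trans (hpos w)) hw0
    rw [← enorm_eq_nnnorm, ← ofReal_norm]
    exact ENNReal.ofReal_le_ofReal h4
  · have hmem : (ρ : ℂ) ∈ spectrum ℂ (G.adjMatrix ℂ) := by
      rw [← spectrum_toLin', ← Module.End.hasEigenvalue_iff_mem_spectrum]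
      refine Module.End.hasEigenvalue_of_hasEigenvector (x := fun i => (x i : ℂ)) ?_
      rw [Module.End.hasEigenvector_iff, Module.End.mem_eigenspace_iff]
      constructor
      · rw [toLin'_apply]
        ext i
        have := congrFun hxe i
        simp only [Pi.smul_apply, smul_eq_mul, mulVec, dotProduct] at this ⊢
        rw [← Complex.ofReal_mul, ← this, hAC]
        simp
      · intro h
        apply hx0
        ext i
        have := congrFun h i
        simpa using this
    have := le_iSup₂ (f := fun (k : ℂ) (_ : k ∈ spectrum ℂ (G.adjMatrix ℂ)) => (‖k‖₊ : ENNReal)) _ hmem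
    refine le_trans (le_of_eq ?_) this
    rw [← enorm_eq_nnnorm, ← ofReal_norm, Complex.norm_real, Real.norm_of_nonneg hρ0]

theorem graphSpectralRadius_congr {V W : Type*} [Fintype V] [Fintype W] {G : SimpleGraph V}
    {H : SimpleGraph W} (e : G ≃g H) : graphSpectralRadius G = graphSpectralRadius H := by
  classical
  have h1 : graphSpectralRadius G = spectralRadius ℂ (G.adjMatrix ℂ) := by
    unfold graphSpectralRadius; congr!
  have h2 : graphSpectralRadius H = spectralRadius ℂ (H.adjMatrix ℂ) := by
    unfold graphSpectralRadius; congr!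
  have h3 : reindexAlgEquiv ℂ ℂ e.toEquiv (G.adjMatrix ℂ) = H.adjMatrix ℂ := by
    ext i j
    have : G.Adj (e.symm i) (e.symm j) ↔ H.Adj i j := e.symm.map_adj_iff
    simp only [coe_reindexAlgEquiv, reindex_apply, submatrix_apply, SimpleGraph.adjMatrix_apply]
    congr 1
    exact propext this
  rw [h1, h2, ← h3]
  simp only [spectralRadius, AlgEquiv.spectrum_eq]
end

/-! ### Entry estimates for the normalized eigenvector -/

section Perron
open Classical

/-- The vertices that are distinct from `i` and not adjacent to it. -/
noncomputable def coNeighbors {V : Type*} [Fintype V] (G : SimpleGraph V) (i : V) : Finset V :=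
  Finset.univ.filter fun j => j ≠ i ∧ ¬ G.Adj i j

/-- The amount by which the degree of `i` falls short of `|V| - 3`. -/
noncomputable def defect {V : Type*} [Fintype V] (G : SimpleGraph V) (i : V) : ℕ :=
  Fintype.card V - 3 - G.degree i

theorem mem_coNeighbors {V : Type*} [Fintype V] {G : SimpleGraph V} {i j : V} :
    j ∈ coNeighbors G i ↔ j ≠ i ∧ ¬ G.Adj i j := by
  simp [coNeighbors]

theorem sum_coNeighbors {V : Type*} [Fintype V] (G : SimpleGraph V) (i : V) (f : V → ℝ) :
    f i + (∑ j ∈ G.neighborFinset i, f j + ∑ j ∈ coNeighbors G i, f j) = ∑ j, f j := by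
  rw [← Finset.sum_union]
  · rw [← Finset.sum_insert]
    · congr 1
      ext j
      simp only [Finset.mem_insert, Finset.mem_union, SimpleGraph.mem_neighborFinset,
        mem_coNeighbors, Finset.mem_univ, iff_true]
      tauto
    · simp [mem_coNeighbors]
  · rw [Finset.disjoint_left]
    intro j hj
    rw [mem_coNeighbors]
    rw [SimpleGraph.mem_neighborFinset] at hj
    tauto

theorem card_coNeighbors {V : Type*} [Fintype V] (G : SimpleGraph V) (i : V) :
    G.degree i + (coNeighbors G i).card + 1 = Fintype.card V := by
  have := sum_coNeighbors G i (fun _ => 1)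
  simp only [Finset.sum_const, nsmul_eq_mul, mul_one, SimpleGraph.card_neighborFinset_eq_degree,
    Finset.card_univ] at this
  have h : ((G.degree i + (coNeighbors G i).card + 1 : ℕ) : ℝ) = (Fintype.card V : ℕ) := by
    push_cast
    linarith
  exact_mod_cast h

/-- `x` is a nonnegative eigenvector of `G` for an eigenvalue `ρ` close to `|V| - 3`, where `G` is
a graph of maximum degree at most `|V| - 3`; the normalization is `∑ x = ρ + 3`. -/
structure NormalizedPerron {V : Type*} [Fintype V] (G : SimpleGraph V) (ρ : ℝ) (x : V → ℝ) :
    Prop where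
  card_ge : 59 ≤ Fintype.card V
  degree_add_le : ∀ i, G.degree i + 3 ≤ Fintype.card V
  nonneg : ∀ i, 0 ≤ x i
  sum_eq : ∑ i, x i = ρ + 3
  eig : ∀ i, ∑ j ∈ G.neighborFinset i, x j = ρ * x i
  gap_le : (Fintype.card V - 3 - ρ) * Fintype.card V ≤ 2

namespace NormalizedPerron
variable {V : Type*} [Fintype V] {G : SimpleGraph V} {ρ : ℝ} {x : V → ℝ}

theorem defect_add_degree (h : NormalizedPerron G ρ x) (i : V) :
    defect G i + G.degree i + 3 = Fintype.card V := by
  have := h.degree_add_le i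
  unfold defect
  omega

theorem cast_defect (h : NormalizedPerron G ρ x) (i : V) :
    (defect G i : ℝ) = Fintype.card V - 3 - G.degree i := by
  have := h.defect_add_degree i
  rw [← this]
  push_cast
  ring

theorem card_ge' (h : NormalizedPerron G ρ x) : (59 : ℝ) ≤ Fintype.card V := by
  exact_mod_cast h.card_ge

theorem gap_le' (h : NormalizedPerron G ρ x) : Fintype.card V - 3 - ρ ≤ 2 / 59 := by
  have h1 := h.gap_le
  have h2 := h.card_ge'
  by_contra h3
  nlinarith

theorem rho_ge (h : NormalizedPerron G ρ x) : 55 ≤ ρ := by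
  linarith [h.gap_le', h.card_ge']

/-- Sum the eigenvalue equation over all vertices and count each x_j once per neighbor of j. -/
theorem sum_defect (h : NormalizedPerron G ρ x) :
    ∑ i, (defect G i : ℝ) * x i = (Fintype.card V - 3 - ρ) * (ρ + 3) := by
  have h1 : ∑ i, ∑ j ∈ G.neighborFinset i, x j = ∑ i, (G.degree i : ℝ) * x i := by
    have : ∀ i, ∑ j ∈ G.neighborFinset i, x j = ∑ j, if G.Adj i j then x j else 0 := by
      intro i
      rw [← Finset.sum_filter]
      congr 1
      ext j
      simp
    simp only [this]
    rw [Finset.sum_comm]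
    refine Finset.sum_congr rfl fun j _ => ?_
    rw [← Finset.sum_filter, Finset.sum_const, nsmul_eq_mul, ← G.card_neighborFinset_eq_degree]
    congr 3
    ext i
    simp [G.adj_comm]
  simp only [h.eig, ← Finset.mul_sum, h.sum_eq] at h1
  simp only [h.cast_defect, sub_mul, Finset.sum_sub_distrib, ← h1, ← Finset.mul_sum, h.sum_eq]

theorem term_nonneg (h : NormalizedPerron G ρ x) (i : V) : 0 ≤ (defect G i : ℝ) * x i :=
  mul_nonneg (Nat.cast_nonneg _) (h.nonneg i)

theorem rho_le (h : NormalizedPerron G ρ x) : ρ + 3 ≤ Fintype.card V := by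
  have h1 : 0 ≤ ∑ i, (defect G i : ℝ) * x i := Finset.sum_nonneg fun i _ => h.term_nonneg i
  rw [h.sum_defect] at h1
  have := h.rho_ge
  by_contra h2
  nlinarith

/-- The total ρ + 3 is chosen for this equation: a vertex with two nonneighbors of entry 1 gets
entry exactly 1. -/
theorem eq_coNeighbors (h : NormalizedPerron G ρ x) (i : V) :
    (ρ + 1) * x i = ρ + 3 - ∑ j ∈ coNeighbors G i, x j := by
  have := sum_coNeighbors G i x
  rw [h.eig, h.sum_eq] at this
  linarith

theorem card_co (h : NormalizedPerron G ρ x) (i : V) :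
    (coNeighbors G i).card = defect G i + 2 := by
  have := card_coNeighbors G i
  have := h.defect_add_degree i
  omega

/-- At a maximal entry the eigenvalue equation gives degree at least ρ, and ρ > |V| - 4. -/
theorem exists_max (h : NormalizedPerron G ρ x) :
    ∃ m, (∀ i, x i ≤ x m) ∧ 0 < x m ∧ defect G m = 0 := by
  have hne : (Finset.univ : Finset V).Nonempty := by
    rw [Finset.univ_nonempty_iff, ← Fintype.card_pos_iff]
    have := h.card_ge
    omega
  obtain ⟨m, -, hm⟩ := Finset.exists_max_image Finset.univ x hne
  have hm' : ∀ i, x i ≤ x m := fun i => hm i (Finset.mem_univ i)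
  have hpos : 0 < x m := by
    by_contra h0
    have : ∑ i, x i ≤ 0 := Finset.sum_nonpos fun i _ => (hm' i).trans (not_lt.1 h0)
    rw [h.sum_eq] at this
    linarith [h.rho_ge]
  refine ⟨m, hm', hpos, ?_⟩
  have h1 : ρ * x m ≤ G.degree m * x m := by
    rw [← h.eig, ← G.card_neighborFinset_eq_degree, ← nsmul_eq_mul]
    exact Finset.sum_le_card_nsmul _ _ _ fun j _ => hm' j
  have h2 : ρ ≤ G.degree m := le_of_mul_le_mul_right h1 hpos
  have h3 := h.cast_defect m
  have h4 := h.gap_le'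
  have h5 : (defect G m : ℝ) < 1 := by linarith
  have h6 : defect G m < 1 := by exact_mod_cast h5
  omega

theorem le_max (h : NormalizedPerron G ρ x) (i : V) : (ρ + 1) * x i ≤ ρ + 3 := by
  obtain ⟨m, hm, -⟩ := h.exists_max
  have h1 := h.eq_coNeighbors m
  have h2 : 0 ≤ ∑ j ∈ coNeighbors G m, x j := Finset.sum_nonneg fun j _ => h.nonneg j
  have := hm i
  have := h.rho_ge
  nlinarith

theorem u_pos (h : NormalizedPerron G ρ x) : 0 < 1 / (ρ + 1) := by
  have := h.rho_ge
  positivity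

theorem u_le (h : NormalizedPerron G ρ x) : 1 / (ρ + 1) ≤ 1 / 56 := by
  have := h.rho_ge
  exact one_div_le_one_div_of_le (by norm_num) (by linarith)

theorem u_mul (h : NormalizedPerron G ρ x) : 1 / (ρ + 1) * (ρ + 1) = 1 := by
  have := h.rho_ge
  field_simp

theorem le_u (h : NormalizedPerron G ρ x) (i : V) : x i ≤ 1 + 2 * (1 / (ρ + 1)) := by
  have h1 := h.le_max i
  have h2 := h.u_mul
  have h3 := h.u_pos
  set u := 1 / (ρ + 1)
  have h4 := mul_le_mul_of_nonneg_left h1 h3.le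
  have h5 : u * ((ρ + 1) * x i) = x i := by rw [← mul_assoc, h2, one_mul]
  rw [h5] at h4
  linarith

/-- Insert the upper bound `le_u` for the `defect G i + 2` nonneighbors into `eq_coNeighbors`. -/
theorem ge_u (h : NormalizedPerron G ρ x) (i : V) :
    1 - defect G i * (1 / (ρ + 1)) - (4 + 2 * defect G i) * (1 / (ρ + 1)) ^ 2 ≤ x i := by
  have h1 := h.eq_coNeighbors i
  have h6 : ∑ j ∈ coNeighbors G i, x j ≤ (defect G i + 2) * (1 + 2 * (1 / (ρ + 1))) := by
    have := Finset.sum_le_card_nsmul (coNeighbors G i) x _ fun j _ => h.le_u j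
    rw [h.card_co, nsmul_eq_mul] at this
    push_cast at this
    exact this
  have h2 := h.u_mul
  have h3 := h.u_pos
  set u := 1 / (ρ + 1)
  have h4 := mul_le_mul_of_nonneg_left h6 h3.le
  have h5 : u * ((ρ + 1) * x i) = x i := by rw [← mul_assoc, h2, one_mul]
  rw [h1] at h5
  nlinarith

theorem inv_rho_le (h : NormalizedPerron G ρ x) : 1 / ρ ≤ 1.02 * (1 / (ρ + 1)) := by
  have := h.rho_ge
  -- The constant 1.02 exceeds 56/55, the value of (ρ + 1)/ρ at ρ = 55.
  rw [mul_one_div, div_le_div_iff₀ (by linarith) (by linarith)]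
  linarith

theorem degree_pos (h : NormalizedPerron G ρ x) (hc : G.Connected) (i : V) : 0 < G.degree i := by
  have : Nontrivial V := by
    rw [← Fintype.one_lt_card_iff_nontrivial]
    have := h.card_ge
    omega
  exact hc.preconnected.degree_pos_of_nontrivial i

/-- A term of `∑ defect * x` at a vertex of small degree, in terms of the neighbors. -/
theorem low_term (h : NormalizedPerron G ρ x) (a : V) {d : ℕ} (hd : G.degree a = d) :
    (1 - d * (1.02 * (1 / (ρ + 1)))) * ∑ j ∈ G.neighborFinset a, x j ≤ defect G a * x a := by
  have h1 := h.eig a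
  have h2 := h.rho_ge
  have h3 : x a = (∑ j ∈ G.neighborFinset a, x j) / ρ := by
    rw [h1]
    field_simp
  have h4 : 0 ≤ ∑ j ∈ G.neighborFinset a, x j := Finset.sum_nonneg fun j _ => h.nonneg j
  have h5 := h.cast_defect a
  have h6 := h.rho_le
  have h7 := h.inv_rho_le
  have h8 : (defect G a : ℝ) * x a = (defect G a / ρ) * ∑ j ∈ G.neighborFinset a, x j := by
    rw [h3]; ring
  rw [h8]
  refine mul_le_mul_of_nonneg_right ?_ h4
  have h9 : (ρ - d) / ρ ≤ defect G a / ρ := by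
    rw [hd] at h5
    gcongr
    linarith
  refine le_trans ?_ h9
  have h10 : (ρ - d) / ρ = 1 - d * (1 / ρ) := by field_simp
  rw [h10]
  have : (0 : ℝ) ≤ d := Nat.cast_nonneg d
  nlinarith

theorem low_le (h : NormalizedPerron G ρ x) (a : V) (hd3 : G.degree a ≤ 3) :
    ρ * x a ≤ 3 * (1 + 2 * (1 / (ρ + 1))) := by
  rw [← h.eig a]
  have := Finset.sum_le_card_nsmul (G.neighborFinset a) x _ fun j _ => h.le_u j
  rw [G.card_neighborFinset_eq_degree, nsmul_eq_mul] at this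
  refine this.trans ?_
  have h3 := h.u_pos
  have : (G.degree a : ℝ) ≤ 3 := by exact_mod_cast hd3
  gcongr

/-- A vertex of degree at most 3 has an entry of at most 3/ρ times the maximum. Next to a maximal
vertex m it would push ρ down to nearly |V| - 4, so all such vertices are among the two nonneighbors
of m. -/
theorem card_low_le (h : NormalizedPerron G ρ x) :
    (Finset.univ.filter fun i => G.degree i ≤ 3).card ≤ 2 := by
  obtain ⟨m, hm, hpos, hm0⟩ := h.exists_max
  have hsub : (Finset.univ.filter fun i => G.degree i ≤ 3) ⊆ coNeighbors G m := by
    intro i hi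
    simp only [Finset.mem_filter, Finset.mem_univ, true_and] at hi
    rw [mem_coNeighbors]
    refine ⟨?_, fun hadj => ?_⟩
    · rintro rfl
      have := h.defect_add_degree i
      have := h.card_ge
      omega
    · have h1 : ∑ j ∈ (G.neighborFinset m).erase i, x j ≤ (G.degree m - 1 : ℕ) • x m := by
        rw [← G.card_neighborFinset_eq_degree, ← Finset.card_erase_of_mem
          (by simpa using hadj : i ∈ G.neighborFinset m)]
        exact Finset.sum_le_card_nsmul _ _ _ fun j _ => hm j
      have h2 := Finset.add_sum_erase (G.neighborFinset m) x (by simpa using hadj)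
      rw [h.eig] at h2
      have h3 := h.defect_add_degree m
      have h4 : ((G.degree m - 1 : ℕ) : ℝ) = Fintype.card V - 4 := by
        have : G.degree m - 1 + 4 = Fintype.card V := by
          have := h.card_ge
          omega
        rw [← this]; push_cast; ring
      rw [nsmul_eq_mul, h4] at h1
      have h5 : ρ * x i ≤ 3 * x m := by
        rw [← h.eig i]
        have := Finset.sum_le_card_nsmul (G.neighborFinset i) x _ fun j _ => hm j
        rw [G.card_neighborFinset_eq_degree, nsmul_eq_mul] at this
        refine this.trans ?_
        have : (G.degree i : ℝ) ≤ 3 := by exact_mod_cast hi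
        gcongr
      have h6 := h.gap_le'
      have h7 := h.rho_ge
      have h8 := h.nonneg i
      nlinarith
  calc _ ≤ _ := Finset.card_le_card hsub
    _ = 2 := by rw [h.card_co, hm0]

/-- The defect is at most |V| - 7 ≤ (ρ + 1) - (5 - 2/59), and 4.9 < 5 - 2/59. -/
theorem mul_defect_le (h : NormalizedPerron G ρ x) (i : V) (hd : 4 ≤ G.degree i) :
    1 / (ρ + 1) * defect G i ≤ 1 - 4.9 * (1 / (ρ + 1)) := by
  have h1 := h.cast_defect i
  have h2 := h.gap_le'
  have h3 : (4 : ℝ) ≤ G.degree i := by exact_mod_cast hd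
  have h4 := h.u_mul
  have h5 := h.u_pos
  nlinarith

/-- The lower bound r(1 - ru - (4 + 2r)u²) from `ge_u` is concave in the defect r. On the range 1 ≤
r ≤ 1/u - 4.9 it is smallest at an end; the right end gives about 2.9, so the minimum is at r = 1.
-/
theorem term_one (h : NormalizedPerron G ρ x) (i : V) (hd : 4 ≤ G.degree i)
    (hr : 1 ≤ defect G i) :
    1 - (1 / (ρ + 1)) - 6 * (1 / (ρ + 1)) ^ 2 ≤ defect G i * x i := by
  have h1 := h.mul_defect_le i hd
  have h2 := h.ge_u i
  have h3 := h.u_pos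
  have h4 : (1 : ℝ) ≤ defect G i := by exact_mod_cast hr
  set u := 1 / (ρ + 1)
  set r := (defect G i : ℝ)
  refine le_trans ?_ (mul_le_mul_of_nonneg_left h2 (by linarith))
  have h5 : 0 ≤ (r - 1) * (1 - 4.9 * u - u * r) := mul_nonneg (by linarith) (by linarith)
  have h6 : 0 ≤ (r - 1) * u := mul_nonneg (by linarith) h3.le
  have h7 : 0 ≤ (r - 1) * u ^ 2 := mul_nonneg (by linarith) (sq_nonneg _)
  have h8 : 0 ≤ (r - 1) * (1 - 4.9 * u - u * r) * u := mul_nonneg h5 h3.le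
  nlinarith

/-- The same concavity, now from r = 3 on: both ends of the range give more than 2. -/
theorem defect_le_two (h : NormalizedPerron G ρ x) (i : V) (hd : 4 ≤ G.degree i)
    (hD : defect G i * x i ≤ 2) : defect G i ≤ 2 := by
  by_contra hr
  have h1 := h.mul_defect_le i hd
  have h2 := h.ge_u i
  have h3 := h.u_pos
  have h3' := h.u_le
  have h4 : (3 : ℝ) ≤ defect G i := by exact_mod_cast (not_le.1 hr : 2 < defect G i)
  set u := 1 / (ρ + 1)
  set r := (defect G i : ℝ)
  have h9 := (mul_le_mul_of_nonneg_left h2 (by linarith : 0 ≤ r)).trans hD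
  have h5 : 0 ≤ (r - 3) * (1 - 4.9 * u - u * r) := mul_nonneg (by linarith) (by linarith)
  have h8 : 0 ≤ (r - 3) * (1 - 4.9 * u - u * r) * u := mul_nonneg h5 h3.le
  have h10 : u * r * u ≤ (1 - 4.9 * u) * u := mul_le_mul_of_nonneg_right h1 h3.le
  nlinarith

end NormalizedPerron
end Perron

/-! ### A small weighted defect sum allows only one deficient vertex -/

section Trichotomy
open Classical
namespace NormalizedPerron
variable {V : Type*} [Fintype V] {G : SimpleGraph V} {ρ : ℝ} {x : V → ℝ}

theorem one_term (h : NormalizedPerron G ρ x) (a : V) :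
    defect G a * x a ≤ ∑ i, (defect G i : ℝ) * x i :=
  Finset.single_le_sum (f := fun i => (defect G i : ℝ) * x i) (fun i _ => h.term_nonneg i)
    (Finset.mem_univ a)

theorem two_terms (h : NormalizedPerron G ρ x) {a b : V} (hab : a ≠ b) :
    defect G a * x a + defect G b * x b ≤ ∑ i, (defect G i : ℝ) * x i := by
  have := Finset.sum_le_univ_sum_of_nonneg (f := fun i => (defect G i : ℝ) * x i) (s := {a, b})
    h.term_nonneg
  rwa [Finset.sum_pair hab] at this

theorem three_terms (h : NormalizedPerron G ρ x) {a b c : V} (hab : a ≠ b) (hac : a ≠ c)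
    (hbc : b ≠ c) :
    defect G a * x a + defect G b * x b + defect G c * x c ≤ ∑ i, (defect G i : ℝ) * x i := by
  have := Finset.sum_le_univ_sum_of_nonneg (f := fun i => (defect G i : ℝ) * x i) (s := {a, b, c})
    h.term_nonneg
  rw [Finset.sum_insert (by simp [hab, hac]), Finset.sum_pair hbc] at this
  linarith

theorem degree_eq_iff (h : NormalizedPerron G ρ x) (i : V) :
    G.degree i = Fintype.card V - 3 ↔ defect G i = 0 := by
  have := h.defect_add_degree i
  omega

theorem sum_lt_two (h : NormalizedPerron G ρ x)
    (hD : ∑ i, (defect G i : ℝ) * x i ≤ 2 - 4 * (1 / (ρ + 1)) + 12 * (1 / (ρ + 1)) ^ 2) :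
    ∑ i, (defect G i : ℝ) * x i < 2 := by
  have := h.u_pos
  have := h.u_le
  nlinarith

theorem defect_le_two' (h : NormalizedPerron G ρ x)
    (hD : ∑ i, (defect G i : ℝ) * x i ≤ 2 - 4 * (1 / (ρ + 1)) + 12 * (1 / (ρ + 1)) ^ 2)
    (i : V) (hi : 4 ≤ G.degree i) : defect G i ≤ 2 :=
  h.defect_le_two i hi ((h.one_term i).trans (h.sum_lt_two hD).le)

/-- The worst case of `ge_u` is defect 2 and u = 1/56. -/
theorem high_ge (h : NormalizedPerron G ρ x)
    (hD : ∑ i, (defect G i : ℝ) * x i ≤ 2 - 4 * (1 / (ρ + 1)) + 12 * (1 / (ρ + 1)) ^ 2)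
    (i : V) (hi : 4 ≤ G.degree i) : 0.96 ≤ x i := by
  have h1 := h.defect_le_two' hD i hi
  have h2 := h.ge_u i
  have h3 := h.u_pos
  have h4 := h.u_le
  have h5 : (defect G i : ℝ) ≤ 2 := by exact_mod_cast h1
  set u := 1 / (ρ + 1)
  nlinarith

theorem term_one_num (h : NormalizedPerron G ρ x) (i : V) (hi : 4 ≤ G.degree i)
    (hr : 1 ≤ defect G i) : 0.98 ≤ defect G i * x i := by
  have h2 := h.term_one i hi hr
  have h3 := h.u_pos
  have h4 := h.u_le
  set u := 1 / (ρ + 1)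
  nlinarith

theorem full_ge (h : NormalizedPerron G ρ x) (i : V) (hr : defect G i = 0) :
    1 - 4 * (1 / (ρ + 1)) ^ 2 ≤ x i := by
  have h2 := h.ge_u i
  rw [hr] at h2
  simpa using h2

/-- A vertex of small degree with a neighbor of large degree accounts for most of `1`. -/
theorem low_term_num (h : NormalizedPerron G ρ x)
    (hD : ∑ i, (defect G i : ℝ) * x i ≤ 2 - 4 * (1 / (ρ + 1)) + 12 * (1 / (ρ + 1)) ^ 2)
    (a : V) (ha : G.degree a ≤ 3) (s : Finset V) (hs : s ⊆ G.neighborFinset a)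
    (hs4 : ∀ i ∈ s, 4 ≤ G.degree i) : 0.9 * s.card ≤ defect G a * x a := by
  have h1 := h.low_term a rfl
  have h2 : s.card • (0.96 : ℝ) ≤ ∑ j ∈ G.neighborFinset a, x j :=
    (Finset.card_nsmul_le_sum s x _ fun i hi => h.high_ge hD i (hs4 i hi)).trans
      (Finset.sum_le_sum_of_subset_of_nonneg hs fun i _ _ => h.nonneg i)
  rw [nsmul_eq_mul] at h2
  have h3 := h.u_pos
  have h4 := h.u_le
  set u := 1 / (ρ + 1)
  have h5 : (G.degree a : ℝ) ≤ 3 := by exact_mod_cast ha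
  have h6 : 0.94 ≤ 1 - G.degree a * (1.02 * u) := by nlinarith
  have h7 : (0 : ℝ) ≤ s.card := Nat.cast_nonneg _
  nlinarith

/-- If no vertex has small degree, then there is exactly one deficient vertex, with defect `2`. -/
theorem of_no_low (h : NormalizedPerron G ρ x)
    (hD : ∑ i, (defect G i : ℝ) * x i ≤ 2 - 4 * (1 / (ρ + 1)) + 12 * (1 / (ρ + 1)) ^ 2)
    (hreg : ∃ i, defect G i ≠ 0) (hlow : ∀ i, 4 ≤ G.degree i) :
    ∃ u, defect G u = 2 ∧ ∀ i ≠ u, defect G i = 0 := by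
  have h3 := h.u_pos
  have h4 := h.u_le
  have hlt := h.sum_lt_two hD
  by_cases h2 : ∃ u, defect G u = 2
  · obtain ⟨u, hu⟩ := h2
    refine ⟨u, hu, fun i hi => ?_⟩
    by_contra hne
    have h5 := h.term_one_num i (hlow i) (Nat.one_le_iff_ne_zero.2 hne)
    have h6 := h.high_ge hD u (hlow u)
    have h7 := h.two_terms hi
    rw [hu] at h7
    push_cast at h7
    linarith
  · exfalso
    push Not at h2
    obtain ⟨i, hi⟩ := hreg
    have hle : ∀ j, defect G j ≤ 1 := fun j => by
      have := h.defect_le_two' hD j (hlow j)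
      have := h2 j
      omega
    by_cases hj : ∃ j, j ≠ i ∧ defect G j ≠ 0
    · obtain ⟨j, hji, hj0⟩ := hj
      have h5 := h.term_one i (hlow i) (Nat.one_le_iff_ne_zero.2 hi)
      have h6 := h.term_one j (hlow j) (Nat.one_le_iff_ne_zero.2 hj0)
      have h7 := h.two_terms hji
      set u := 1 / (ρ + 1)
      nlinarith
    · push Not at hj
      -- A total defect of 1 would make 1 + 2|E| + 3n = n², but n(n - 3) is even.
      have h5 : ∑ j, defect G j = 1 := by
        rw [Finset.sum_eq_single i (fun j _ hji => hj j hji) (by simp)]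
        have := hle i
        omega
      have h6 : ∑ j, (defect G j + G.degree j + 3) = Fintype.card V * Fintype.card V := by
        simp only [h.defect_add_degree, Finset.sum_const, Finset.card_univ, smul_eq_mul]
      rw [Finset.sum_add_distrib, Finset.sum_add_distrib, h5, G.sum_degrees_eq_twice_card_edges,
        Finset.sum_const, Finset.card_univ, smul_eq_mul] at h6
      rcases Nat.even_or_odd' (Fintype.card V) with ⟨k, hk | hk⟩ <;> rw [hk] at h6
      · have : 2 * k * (2 * k) = 4 * (k * k) := by ring
        omega
      · have : (2 * k + 1) * (2 * k + 1) = 4 * (k * k) + 4 * k + 1 := by ring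
        omega

/-- If exactly one vertex has small degree, then it is the only deficient vertex and has degree at
most `2`. -/
theorem of_one_low (h : NormalizedPerron G ρ x)
    (hD : ∑ i, (defect G i : ℝ) * x i ≤ 2 - 4 * (1 / (ρ + 1)) + 12 * (1 / (ρ + 1)) ^ 2)
    (hc : G.Connected) {a : V} (ha : G.degree a ≤ 3) (hlow : ∀ i ≠ a, 4 ≤ G.degree i) :
    G.degree a ≤ 2 ∧ ∀ i ≠ a, defect G i = 0 := by
  have h3 := h.u_pos
  have h4 := h.u_le
  have hlt := h.sum_lt_two hD
  have hpos := h.degree_pos hc a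
  have hN : ∀ i ∈ G.neighborFinset a, 4 ≤ G.degree i := fun i hi => hlow i (by
    rintro rfl
    simp at hi)
  have h5 := h.low_term_num hD a ha _ subset_rfl hN
  rw [G.card_neighborFinset_eq_degree] at h5
  have h6 := h.one_term a
  have h7 : G.degree a ≤ 2 := by
    by_contra h8
    have : (3 : ℝ) ≤ G.degree a := by exact_mod_cast (not_le.1 h8 : 2 < G.degree a)
    linarith
  refine ⟨h7, fun w hw => ?_⟩
  by_contra hw0
  have hw1 := Nat.one_le_iff_ne_zero.2 hw0
  have h8 := h.term_one w (hlow w hw) hw1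
  have h8' := h.term_one_num w (hlow w hw) hw1
  have h9 := h.two_terms hw
  -- A pendant a with neighbor v leaves little slack, since v may itself be deficient. If v has
  -- defect 2, its term and that of a exceed 2. Otherwise x v ≥ 1 - u - 6u², and the terms of a and
  -- w add up to about 2 - 3.02u, above 2 - 4u + 12u². For degree 2 the crude bounds 1.8 and 0.98
  -- suffice.
  by_cases h10 : G.degree a = 1
  · obtain ⟨v, hv⟩ := Finset.card_eq_one.1 ((G.card_neighborFinset_eq_degree a).trans h10)
    have hva : v ∈ G.neighborFinset a := by simp [hv]
    have hva' : v ≠ a := by rintro rfl; simp at hva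
    have h11 := h.low_term a h10
    rw [hv, Finset.sum_singleton] at h11
    have h12 := h.defect_le_two' hD v (hN v hva)
    by_cases h13 : defect G v = 2
    · have h14 := h.high_ge hD v (hN v hva)
      have h15 := h.two_terms hva'
      rw [h13] at h15
      rw [h10] at h5
      push_cast at h15 h5
      linarith
    · have h14 : (defect G v : ℝ) ≤ 1 := by
        exact_mod_cast (by omega : defect G v ≤ 1)
      have h15 := h.ge_u v
      set u := 1 / (ρ + 1)
      push_cast at h11
      have h16 : 1 - u - 6 * u ^ 2 ≤ x v := by nlinarith
      have h17 : (1 - 1.02 * u) * (1 - u - 6 * u ^ 2) ≤ defect G a * x a := by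
        refine le_trans ?_ h11
        rw [one_mul]
        exact mul_le_mul_of_nonneg_left h16 (by linarith)
      nlinarith
  · have : (2 : ℝ) ≤ G.degree a := by exact_mod_cast (by omega : 2 ≤ G.degree a)
    linarith

/-- Two vertices of small degree that are not adjacent are impossible. -/
theorem not_two_low_of_not_adj (h : NormalizedPerron G ρ x)
    (hD : ∑ i, (defect G i : ℝ) * x i ≤ 2 - 4 * (1 / (ρ + 1)) + 12 * (1 / (ρ + 1)) ^ 2)
    (hc : G.Connected) {a b : V} (hab : a ≠ b) (ha : G.degree a ≤ 3) (hb : G.degree b ≤ 3)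
    (hlow : ∀ i, i ≠ a → i ≠ b → 4 ≤ G.degree i) (hadj : ¬ G.Adj a b) : False := by
  have h3 := h.u_pos
  have h4 := h.u_le
  have hlt := h.sum_lt_two hD
  have hpa := h.degree_pos hc a
  have hpb := h.degree_pos hc b
  have hNa : ∀ i ∈ G.neighborFinset a, i ≠ a ∧ i ≠ b := fun i hi => by
    rw [SimpleGraph.mem_neighborFinset] at hi
    exact ⟨hi.ne', by rintro rfl; exact hadj hi⟩
  have hNb : ∀ i ∈ G.neighborFinset b, i ≠ a ∧ i ≠ b := fun i hi => by
    rw [SimpleGraph.mem_neighborFinset] at hi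
    exact ⟨by rintro rfl; exact hadj hi.symm, hi.ne'⟩
  have h5 := h.low_term_num hD a ha _ subset_rfl fun i hi => hlow i (hNa i hi).1 (hNa i hi).2
  have h6 := h.low_term_num hD b hb _ subset_rfl fun i hi => hlow i (hNb i hi).1 (hNb i hi).2
  rw [G.card_neighborFinset_eq_degree] at h5 h6
  have h7 := h.two_terms hab
  have h5' : (1 : ℝ) ≤ G.degree a := by exact_mod_cast hpa
  have h6' : (1 : ℝ) ≤ G.degree b := by exact_mod_cast hpb
  have hfull : ∀ i, i ≠ a → i ≠ b → defect G i = 0 := by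
    intro i hia hib
    by_contra hne
    have h8 := h.term_one_num i (hlow i hia hib) (Nat.one_le_iff_ne_zero.2 hne)
    have h9 := h.three_terms hab hia.symm hib.symm
    linarith
  -- Two pendant vertices at full vertices contribute about 2 - 2.04u; degree sum 3 or more already
  -- gives 2.7.
  by_cases h1 : G.degree a = 1 ∧ G.degree b = 1
  · obtain ⟨v, hv⟩ := Finset.card_eq_one.1 ((G.card_neighborFinset_eq_degree a).trans h1.1)
    obtain ⟨w, hw⟩ := Finset.card_eq_one.1 ((G.card_neighborFinset_eq_degree b).trans h1.2)
    have h11 := h.low_term a h1.1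
    have h12 := h.low_term b h1.2
    rw [hv, Finset.sum_singleton] at h11
    rw [hw, Finset.sum_singleton] at h12
    have h13 := hNa v (by simp [hv])
    have h14 := hNb w (by simp [hw])
    have h15 := h.full_ge v (hfull v h13.1 h13.2)
    have h16 := h.full_ge w (hfull w h14.1 h14.2)
    set u := 1 / (ρ + 1)
    push_cast at h11 h12
    have h17 := mul_le_mul_of_nonneg_left h15 (by linarith : 0 ≤ 1 - 1.02 * u)
    have h18 := mul_le_mul_of_nonneg_left h16 (by linarith : 0 ≤ 1 - 1.02 * u)
    nlinarith
  · have h8 : 3 ≤ G.degree a + G.degree b := by omega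
    have h9 : (3 : ℝ) ≤ G.degree a + G.degree b := by exact_mod_cast h8
    linarith

/-- Two adjacent vertices of small degree, one of them pendant: the counting and the estimate when
the other one has degree two. -/
theorem not_pendant_path (h : NormalizedPerron G ρ x)
    (hD : ∑ i, (defect G i : ℝ) * x i ≤ 2 - 4 * (1 / (ρ + 1)) + 12 * (1 / (ρ + 1)) ^ 2)
    {a b : V} (hlow : ∀ i, i ≠ a → i ≠ b → 4 ≤ G.degree i) (hadj : G.Adj a b)
    (ha : G.degree a = 2) (hb : G.degree b = 1) : False := by
  have h3 := h.u_pos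
  have h4 := h.u_le
  have hlt := h.sum_lt_two hD
  have hbN : ∀ i, G.Adj b i → i = a := by
    intro i hi
    obtain ⟨c, hcb⟩ := Finset.card_eq_one.1 ((G.card_neighborFinset_eq_degree b).trans hb)
    have h1 : a ∈ G.neighborFinset b := by simpa using hadj.symm
    have h2 : i ∈ G.neighborFinset b := by simpa using hi
    rw [hcb, Finset.mem_singleton] at h1 h2
    rw [h1, h2]
  obtain ⟨v, hv⟩ : ∃ v, (G.neighborFinset a).erase b = {v} := by
    rw [← Finset.card_eq_one, Finset.card_erase_of_mem (by simpa using hadj),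
      G.card_neighborFinset_eq_degree, ha]
  have hv' : v ∈ (G.neighborFinset a).erase b := by simp [hv]
  rw [Finset.mem_erase, SimpleGraph.mem_neighborFinset] at hv'
  obtain ⟨hvb, hva⟩ := hv'
  -- Besides b, the vertex v misses some w. This w also misses a and b, so it has three nonneighbors
  -- and is deficient. The terms of a and w then add up to about 2 - 3.04u.
  obtain ⟨w, hw, hwb⟩ : ∃ w ∈ coNeighbors G v, w ≠ b := by
    refine Finset.exists_mem_ne ?_ b
    rw [h.card_co]
    omega
  rw [mem_coNeighbors] at hw
  have hwa : w ≠ a := by rintro rfl; exact hw.2 hva.symm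
  have hw0 : 1 ≤ defect G w := by
    have : ({a, b, v} : Finset V) ⊆ coNeighbors G w := by
      intro i hi
      simp only [Finset.mem_insert, Finset.mem_singleton] at hi
      rw [mem_coNeighbors]
      rcases hi with rfl | rfl | rfl
      · refine ⟨hwa.symm, fun hadj' => ?_⟩
        have h1 : w ∈ (G.neighborFinset i).erase b := by
          rw [Finset.mem_erase, SimpleGraph.mem_neighborFinset]
          exact ⟨hwb, hadj'.symm⟩
        rw [hv, Finset.mem_singleton] at h1
        exact hw.1 h1
      · exact ⟨hwb.symm, fun hadj' => hwa (hbN w hadj'.symm)⟩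
      · exact ⟨hw.1.symm, fun hadj' => hw.2 hadj'.symm⟩
    have h1 := Finset.card_le_card this
    rw [h.card_co, Finset.card_insert_of_notMem, Finset.card_pair hvb.symm] at h1
    · omega
    · simp [hadj.ne, hva.ne]
  have h5 := h.low_term_num hD a (by omega) {v} (by simpa using hva)
    (by simpa using hlow v hva.ne' hvb)
  simp only [Finset.card_singleton, Nat.cast_one, mul_one] at h5
  have h6 := h.term_one w (hlow w hwa hwb) hw0
  have h6' := h.term_one_num w (hlow w hwa hwb) hw0
  have hv0 : defect G v = 0 := by
    by_contra hne
    have h8 := h.term_one_num v (hlow v hva.ne' hvb) (Nat.one_le_iff_ne_zero.2 hne)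
    have h9 := h.three_terms hva.ne hwa.symm hw.1.symm
    linarith
  have h7 := h.full_ge v hv0
  have h8 := h.low_term a ha
  rw [← Finset.add_sum_erase (G.neighborFinset a) x (by simpa using hadj), hv,
    Finset.sum_singleton] at h8
  have h9 := h.nonneg b
  have h10 := h.two_terms hwa.symm
  set u := 1 / (ρ + 1)
  push_cast at h8
  have h11 := mul_le_mul_of_nonneg_left (by linarith : 1 - 4 * u ^ 2 ≤ x b + x v)
    (by linarith : 0 ≤ 1 - 2 * (1.02 * u))
  nlinarith

theorem x_low_ge (h : NormalizedPerron G ρ x) {a : V} {s : Finset V}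
    (hs : s ⊆ G.neighborFinset a) : (1 / (ρ + 1)) * ∑ i ∈ s, x i ≤ x a := by
  have h1 : ∑ i ∈ s, x i ≤ ρ * x a := by
    rw [← h.eig]
    exact Finset.sum_le_sum_of_subset_of_nonneg hs fun i _ _ => h.nonneg i
  have h2 := h.u_mul
  have h3 := h.u_pos
  have h4 := h.nonneg a
  have h5 := h.rho_ge
  have h6 : 1 / (ρ + 1) * (ρ * x a) = (1 / (ρ + 1) * (ρ + 1)) * x a - 1 / (ρ + 1) * x a := by ring
  have h7 := mul_le_mul_of_nonneg_left h1 h3.le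
  rw [h6, h2] at h7
  have := mul_nonneg h3.le h4
  linarith

/-- Each of a and b has one full neighbor, and also sees the other one, whose entry is about u.
Without this extra u the two terms would give only 2 - 4.08u; with it they give about 2 - 2.08u. -/
theorem not_two_low_of_degree_two (h : NormalizedPerron G ρ x)
    (hD : ∑ i, (defect G i : ℝ) * x i ≤ 2 - 4 * (1 / (ρ + 1)) + 12 * (1 / (ρ + 1)) ^ 2)
    {a b : V} (hlow : ∀ i, i ≠ a → i ≠ b → 4 ≤ G.degree i) (hadj : G.Adj a b)
    (ha : G.degree a = 2) (hb : G.degree b = 2) : False := by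
  have h3 := h.u_pos
  have h4 := h.u_le
  have hlt := h.sum_lt_two hD
  obtain ⟨v, hv⟩ : ∃ v, (G.neighborFinset a).erase b = {v} := by
    rw [← Finset.card_eq_one, Finset.card_erase_of_mem (by simpa using hadj),
      G.card_neighborFinset_eq_degree, ha]
  obtain ⟨w, hw⟩ : ∃ w, (G.neighborFinset b).erase a = {w} := by
    rw [← Finset.card_eq_one, Finset.card_erase_of_mem (by simpa using hadj.symm),
      G.card_neighborFinset_eq_degree, hb]
  have hv' : v ∈ (G.neighborFinset a).erase b := by simp [hv]
  rw [Finset.mem_erase, SimpleGraph.mem_neighborFinset] at hv'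
  obtain ⟨hvb, hva⟩ := hv'
  have hw' : w ∈ (G.neighborFinset b).erase a := by simp [hw]
  rw [Finset.mem_erase, SimpleGraph.mem_neighborFinset] at hw'
  obtain ⟨hwa, hwb⟩ := hw'
  have h5 := h.low_term_num hD a (by omega) {v} (by simpa using hva)
    (by simpa using hlow v hva.ne' hvb)
  have h6 := h.low_term_num hD b (by omega) {w} (by simpa using hwb)
    (by simpa using hlow w hwa hwb.ne')
  simp only [Finset.card_singleton, Nat.cast_one, mul_one] at h5 h6
  have hfull : ∀ i, i ≠ a → i ≠ b → defect G i = 0 := by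
    intro i hia hib
    by_contra hne
    have h8 := h.term_one_num i (hlow i hia hib) (Nat.one_le_iff_ne_zero.2 hne)
    have h9 := h.three_terms hadj.ne hia.symm hib.symm
    linarith
  have h7 := h.full_ge v (hfull v hva.ne' hvb)
  have h8 := h.full_ge w (hfull w hwa hwb.ne')
  have h9 := h.low_term a ha
  rw [← Finset.add_sum_erase (G.neighborFinset a) x (by simpa using hadj), hv,
    Finset.sum_singleton] at h9
  have h10 := h.low_term b hb
  rw [← Finset.add_sum_erase (G.neighborFinset b) x (by simpa using hadj.symm), hw,
    Finset.sum_singleton] at h10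
  have h11 := h.x_low_ge (a := a) (s := {v}) (by simpa using hva)
  have h12 := h.x_low_ge (a := b) (s := {w}) (by simpa using hwb)
  rw [Finset.sum_singleton] at h11 h12
  have h13 := h.two_terms hadj.ne
  set u := 1 / (ρ + 1)
  push_cast at h9 h10
  have h14 := mul_le_mul_of_nonneg_left h7 h3.le
  have h15 := mul_le_mul_of_nonneg_left h8 h3.le
  have h16 := mul_le_mul_of_nonneg_left
    (by linarith : (1 - 4 * u ^ 2) + u * (1 - 4 * u ^ 2) ≤ x b + x v)
    (by linarith : 0 ≤ 1 - 2 * (1.02 * u))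
  have h17 := mul_le_mul_of_nonneg_left
    (by linarith : (1 - 4 * u ^ 2) + u * (1 - 4 * u ^ 2) ≤ x a + x w)
    (by linarith : 0 ≤ 1 - 2 * (1.02 * u))
  nlinarith

/-- The other two neighbors of a miss b, whose entry is small, so their entries exceed 1 by nearly
u. The term of a is then about 2 - 4.5u, and the pendant b adds about x a, which is at least 2u. -/
theorem not_pendant_triple (h : NormalizedPerron G ρ x)
    (hD : ∑ i, (defect G i : ℝ) * x i ≤ 2 - 4 * (1 / (ρ + 1)) + 12 * (1 / (ρ + 1)) ^ 2)
    {a b : V} (hlow : ∀ i, i ≠ a → i ≠ b → 4 ≤ G.degree i) (hadj : G.Adj a b)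
    (ha : G.degree a = 3) (hb : G.degree b = 1) : False := by
  have h3 := h.u_pos
  have h4 := h.u_le
  have hlt := h.sum_lt_two hD
  have hbN : ∀ i, G.Adj b i → i = a := by
    intro i hi
    obtain ⟨c, hcb⟩ := Finset.card_eq_one.1 ((G.card_neighborFinset_eq_degree b).trans hb)
    have h1 : a ∈ G.neighborFinset b := by simpa using hadj.symm
    have h2 : i ∈ G.neighborFinset b := by simpa using hi
    rw [hcb, Finset.mem_singleton] at h1 h2
    rw [h1, h2]
  obtain ⟨v, w, hvw, hN⟩ : ∃ v w, v ≠ w ∧ (G.neighborFinset a).erase b = {v, w} := by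
    rw [← Finset.card_eq_two, Finset.card_erase_of_mem (by simpa using hadj),
      G.card_neighborFinset_eq_degree, ha]
  have hmem : ∀ i ∈ ({v, w} : Finset V), i ≠ b ∧ G.Adj a i := by
    intro i hi
    rw [← hN, Finset.mem_erase, SimpleGraph.mem_neighborFinset] at hi
    exact hi
  have h5 := h.low_term_num hD a (by omega) {v, w}
    (fun i hi => by simpa using (hmem i hi).2)
    (fun i hi => hlow i (hmem i hi).2.ne' (hmem i hi).1)
  rw [Finset.card_pair hvw] at h5
  have hfull : ∀ i ∈ ({v, w} : Finset V), defect G i = 0 := by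
    intro i hi
    by_contra hne
    have h8 := h.term_one_num i (hlow i (hmem i hi).2.ne' (hmem i hi).1)
      (Nat.one_le_iff_ne_zero.2 hne)
    have h9 := h.two_terms (hmem i hi).2.ne
    push_cast at h5
    linarith
  have hxb := h.low_le b (by omega)
  have hbig : ∀ i ∈ ({v, w} : Finset V), 1 + 0.8 * (1 / (ρ + 1)) ≤ x i := by
    intro i hi
    have h6 := h.eq_coNeighbors i
    have hib : b ∈ coNeighbors G i := by
      rw [mem_coNeighbors]
      exact ⟨(hmem i hi).1.symm, fun hadj' => (hmem i hi).2.ne' (hbN i hadj'.symm)⟩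
    rw [← Finset.add_sum_erase _ _ hib] at h6
    have h7 := Finset.sum_le_card_nsmul ((coNeighbors G i).erase b) x _ fun j _ => h.le_u j
    rw [Finset.card_erase_of_mem hib, h.card_co, hfull i hi] at h7
    simp only [zero_add, Nat.add_one_sub_one, one_smul] at h7
    have h8 := h.u_mul
    have h9 := h.rho_ge
    have h10 : x b ≤ 0.06 := by
      have := h.nonneg b
      nlinarith
    have h11 : (1 / (ρ + 1)) * ((ρ + 1) * x i) = x i := by rw [← mul_assoc, h8, one_mul]
    rw [h6] at h11
    set u := 1 / (ρ + 1)
    have h12 : (ρ + 1) + 0.8 ≤ ρ + 3 - (x b + ∑ j ∈ (coNeighbors G i).erase b, x j) := by linarith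
    have h13 := mul_le_mul_of_nonneg_left h12 h3.le
    rw [h11, mul_add, h8] at h13
    linarith
  have h7 := hbig v (by simp)
  have h8 := hbig w (by simp)
  have h9 := h.low_term a ha
  rw [← Finset.add_sum_erase (G.neighborFinset a) x (by simpa using hadj), hN,
    Finset.sum_pair hvw] at h9
  have h10 := h.low_term b hb
  have hb1 : x a ≤ ∑ j ∈ G.neighborFinset b, x j :=
    Finset.single_le_sum (f := x) (fun i _ => h.nonneg i) (by simpa using hadj.symm)
  have h11 := h.x_low_ge (a := a) (s := {v, w}) (fun i hi => by simpa using (hmem i hi).2)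
  rw [Finset.sum_pair hvw] at h11
  have h13 := h.two_terms hadj.ne
  have h14 := h.nonneg b
  set u := 1 / (ρ + 1)
  push_cast at h9 h10
  have h15 := mul_le_mul_of_nonneg_left (by linarith : 2 + 1.6 * u ≤ x b + (x v + x w))
    (by linarith : 0 ≤ 1 - 3 * (1.02 * u))
  have h16 := mul_le_mul_of_nonneg_left (by linarith : 2 + 1.6 * u ≤ x v + x w) h3.le
  have h17 := mul_le_mul_of_nonneg_left ((h16.trans h11).trans hb1)
    (by linarith : 0 ≤ 1 - 1 * (1.02 * u))
  nlinarith

theorem not_two_low (h : NormalizedPerron G ρ x)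
    (hD : ∑ i, (defect G i : ℝ) * x i ≤ 2 - 4 * (1 / (ρ + 1)) + 12 * (1 / (ρ + 1)) ^ 2)
    (hc : G.Connected) {a b : V} (hab : a ≠ b) (ha : G.degree a ≤ 3) (hb : G.degree b ≤ 3)
    (hlow : ∀ i, i ≠ a → i ≠ b → 4 ≤ G.degree i) : False := by
  by_cases hadj : G.Adj a b
  swap
  · exact h.not_two_low_of_not_adj hD hc hab ha hb hlow hadj
  have hlow' : ∀ i, i ≠ b → i ≠ a → 4 ≤ G.degree i := fun i h1 h2 => hlow i h2 h1
  have hlt := h.sum_lt_two hD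
  have hpa := h.degree_pos hc a
  have hpb := h.degree_pos hc b
  have hpen : ∀ {c d : V}, G.Adj c d → G.degree c = 1 → G.neighborFinset c = {d} := by
    intro c d hcd hc1
    obtain ⟨e, he⟩ := Finset.card_eq_one.1 ((G.card_neighborFinset_eq_degree c).trans hc1)
    have h1 : d ∈ G.neighborFinset c := by simpa using hcd
    rw [he, Finset.mem_singleton] at h1
    rw [he, h1]
  have hterm : ∀ c d, G.Adj c d → G.degree c ≤ 3 → (∀ i, i ≠ c → i ≠ d → 4 ≤ G.degree i) →
      0.9 * ((G.degree c : ℝ) - 1) ≤ defect G c * x c := by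
    intro c d hcd hc3 hcd4
    have h1 := h.low_term_num hD c hc3 ((G.neighborFinset c).erase d) (Finset.erase_subset _ _)
      (fun i hi => by
        rw [Finset.mem_erase, SimpleGraph.mem_neighborFinset] at hi
        exact hcd4 i hi.2.ne' hi.1)
    have hpc := h.degree_pos hc c
    rw [Finset.card_erase_of_mem (by simpa using hcd), G.card_neighborFinset_eq_degree,
      Nat.cast_sub hpc] at h1
    simpa using h1
  have h5 := hterm a b hadj ha hlow
  have h6 := hterm b a hadj.symm hb hlow'
  have h7 := h.two_terms hab
  -- Leaving out the edge ab, the two terms are at least 0.9 times the degree sum less 2; a degree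
  -- sum of 5 would give 2.7.
  have h8 : G.degree a + G.degree b ≤ 4 := by
    by_contra h9
    have : (5 : ℝ) ≤ G.degree a + G.degree b := by
      exact_mod_cast (not_le.1 h9 : 4 < G.degree a + G.degree b)
    linarith
  have hcases : (G.degree a = 1 ∧ G.degree b = 1) ∨ (G.degree a = 2 ∧ G.degree b = 1) ∨
      (G.degree a = 1 ∧ G.degree b = 2) ∨ (G.degree a = 2 ∧ G.degree b = 2) ∨
      (G.degree a = 3 ∧ G.degree b = 1) ∨ (G.degree a = 1 ∧ G.degree b = 3) := by omega
  rcases hcases with ⟨h1, h2⟩ | ⟨h1, h2⟩ | ⟨h1, h2⟩ | ⟨h1, h2⟩ | ⟨h1, h2⟩ | ⟨h1, h2⟩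
  -- Two adjacent pendant vertices form a whole component.
  · have hclosed : ∀ i j, G.Adj i j → i ∈ ({a, b} : Set V) → j ∈ ({a, b} : Set V) := by
      intro i j hij hi
      rcases hi with rfl | rfl
      · have : j ∈ G.neighborFinset i := by simpa using hij
        rw [hpen hadj h1, Finset.mem_singleton] at this
        simp [this]
      · have : j ∈ G.neighborFinset i := by simpa using hij
        rw [hpen hadj.symm h2, Finset.mem_singleton] at this
        simp [this]
    have hall : ∀ i, i ∈ ({a, b} : Set V) := by
      intro i
      obtain ⟨p⟩ := hc.preconnected a i
      have : ∀ {c d : V}, G.Walk c d → c ∈ ({a, b} : Set V) → d ∈ ({a, b} : Set V) := by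
        intro c d p
        induction p with
        | nil => exact id
        | cons hcd _ ih => exact fun hc' => ih (hclosed _ _ hcd hc')
      exact this p (by simp)
    have h9 : (Finset.univ : Finset V) ⊆ {a, b} := fun i _ => by simpa using hall i
    have h10 := Finset.card_le_card h9
    rw [Finset.card_univ, Finset.card_pair hab] at h10
    have := h.card_ge
    omega
  · exact h.not_pendant_path hD hlow hadj h1 h2
  · exact h.not_pendant_path hD hlow' hadj.symm h2 h1
  · exact h.not_two_low_of_degree_two hD hlow hadj h1 h2
  · exact h.not_pendant_triple hD hlow hadj h1 h2
  · exact h.not_pendant_triple hD hlow' hadj.symm h2 h1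

theorem trichotomy (h : NormalizedPerron G ρ x)
    (hD : ∑ i, (defect G i : ℝ) * x i ≤ 2 - 4 * (1 / (ρ + 1)) + 12 * (1 / (ρ + 1)) ^ 2)
    (hc : G.Connected) (hreg : ∃ i, defect G i ≠ 0) :
    ∃ a, (G.degree a = 1 ∨ G.degree a = 2 ∨ defect G a = 2) ∧ ∀ i ≠ a, defect G i = 0 := by
  have hcard := h.card_low_le
  set L := Finset.univ.filter fun i => G.degree i ≤ 3 with hL
  have hmem : ∀ i, i ∈ L ↔ G.degree i ≤ 3 := by simp [hL]
  have hmem' : ∀ i, i ∉ L → 4 ≤ G.degree i := by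
    intro i hi
    rw [hmem] at hi
    omega
  have hcases : L.card = 0 ∨ L.card = 1 ∨ L.card = 2 := by omega
  rcases hcases with h0 | h1 | h2
  · rw [Finset.card_eq_zero] at h0
    obtain ⟨u, hu, hu'⟩ := h.of_no_low hD hreg fun i => hmem' i (by simp [h0])
    exact ⟨u, Or.inr (Or.inr hu), hu'⟩
  · obtain ⟨a, ha⟩ := Finset.card_eq_one.1 h1
    obtain ⟨h2, h3⟩ := h.of_one_low hD hc ((hmem a).1 (by simp [ha]))
      fun i hi => hmem' i (by simpa [ha] using hi)
    have := h.degree_pos hc a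
    exact ⟨a, by omega, h3⟩
  · obtain ⟨a, b, hab, hL2⟩ := Finset.card_eq_two.1 h2
    exact (h.not_two_low hD hc hab ((hmem a).1 (by simp [hL2])) ((hmem b).1 (by simp [hL2]))
      fun i hia hib => hmem' i (by simp [hL2, hia, hib])).elim

end NormalizedPerron
end Trichotomy

/-! ### From a bound on the gap to the deficient vertex and its neighborhood -/

section Structure
open Classical
namespace NormalizedPerron
variable {V : Type*} [Fintype V] {G : SimpleGraph V} {ρ : ℝ} {x : V → ℝ}

/-- Converts a bound in 1/n into one in u. As n ≤ ρ + 4, the product (u - 3u²)n is at most 1 - 9u²,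
so 1/n ≥ u - 3u². -/
theorem sum_le_of_gap (h : NormalizedPerron G ρ x)
    (hgap : (Fintype.card V - 3 - ρ) * Fintype.card V ≤ 2 - 4 * (1 / (Fintype.card V : ℝ))) :
    ∑ i, (defect G i : ℝ) * x i ≤ 2 - 4 * (1 / (ρ + 1)) + 12 * (1 / (ρ + 1)) ^ 2 := by
  rw [h.sum_defect]
  have h1 := h.card_ge'
  have h2 := h.rho_le
  have h3 := h.gap_le'
  have h4 := h.u_pos
  have h5 := h.u_mul
  have h6 := h.rho_ge
  have h7 : (Fintype.card V - 3 - ρ) * (ρ + 3) ≤ (Fintype.card V - 3 - ρ) * Fintype.card V :=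
    mul_le_mul_of_nonneg_left h2 (by linarith)
  refine (h7.trans hgap).trans ?_
  have h8 : 1 / (ρ + 1) - 3 * (1 / (ρ + 1)) ^ 2 ≤ 1 / (Fintype.card V : ℝ) := by
    rw [le_div_iff₀ (by linarith)]
    set u := 1 / (ρ + 1)
    have h9 : u ≤ 1 / 56 := h.u_le
    have h10 : 0 ≤ u - 3 * u ^ 2 := by nlinarith
    have h11 : (u - 3 * u ^ 2) * Fintype.card V ≤ (u - 3 * u ^ 2) * ((ρ + 1) + 3) :=
      mul_le_mul_of_nonneg_left (by linarith) h10
    have h12 : (u - 3 * u ^ 2) * ((ρ + 1) + 3) =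
      u * (ρ + 1) - 3 * u * (u * (ρ + 1)) + 3 * u - 9 * u ^ 2 := by ring
    rw [h12, h5] at h11
    nlinarith
  linarith

theorem sum_eq_single (_ : NormalizedPerron G ρ x) {a : V} (ha : ∀ i ≠ a, defect G i = 0) :
    ∑ i, (defect G i : ℝ) * x i = defect G a * x a :=
  Finset.sum_eq_single a (fun i _ hi => by rw [ha i hi]; simp) (by simp)

/-- A single vertex of defect `2` makes the gap too large. -/
theorem not_single_defect_two (h : NormalizedPerron G ρ x) {a : V} (ha : defect G a = 2)
    (hfull : ∀ i ≠ a, defect G i = 0)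
    (hgap : Fintype.card V - 3 - ρ ≤ 2 * (1 / (Fintype.card V : ℝ)) -
      4 * (1 / (Fintype.card V : ℝ)) ^ 2 - 8 * (1 / (Fintype.card V : ℝ)) ^ 3) : False := by
  have hsum := h.sum_defect
  rw [h.sum_eq_single hfull, ha] at hsum
  have h1 := h.card_ge'
  have h2 := h.rho_le
  have h4 := h.u_pos
  have h4' := h.u_le
  have h5 := h.u_mul
  -- The complement equation is iterated: a lower bound for all entries gives an upper bound away
  -- from a, which gives a sharper lower bound at a.
  have hge : ∀ i, 1 - 2 * (1 / (ρ + 1)) - 8 * (1 / (ρ + 1)) ^ 2 ≤ x i := by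
    intro i
    have h6 := h.ge_u i
    have h7 : (defect G i : ℝ) ≤ 2 := by
      by_cases hi : i = a
      · rw [hi, ha]; norm_num
      · rw [hfull i hi]; norm_num
    set u := 1 / (ρ + 1)
    nlinarith
  have hle : ∀ i ≠ a, x i ≤ 1 + 4 * (1 / (ρ + 1)) ^ 2 + 16 * (1 / (ρ + 1)) ^ 3 := by
    intro i hi
    have h6 := h.eq_coNeighbors i
    have h7 := Finset.card_nsmul_le_sum (coNeighbors G i) x _ fun j _ => hge j
    rw [h.card_co, hfull i hi, nsmul_eq_mul] at h7
    push_cast at h7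
    have h8 : (1 / (ρ + 1)) * ((ρ + 1) * x i) = x i := by rw [← mul_assoc, h5, one_mul]
    rw [h6] at h8
    set u := 1 / (ρ + 1)
    have h9 := mul_le_mul_of_nonneg_left h7 h4.le
    nlinarith
  have hxa : 1 - 2 * (1 / (ρ + 1)) - 16 * (1 / (ρ + 1)) ^ 3 - 64 * (1 / (ρ + 1)) ^ 4 ≤ x a := by
    have h6 := h.eq_coNeighbors a
    have h7 := Finset.sum_le_card_nsmul (coNeighbors G a) x _ fun j hj =>
      hle j (mem_coNeighbors.1 hj).1
    rw [h.card_co, ha, nsmul_eq_mul] at h7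
    push_cast at h7
    have h8 : (1 / (ρ + 1)) * ((ρ + 1) * x a) = x a := by rw [← mul_assoc, h5, one_mul]
    rw [h6] at h8
    set u := 1 / (ρ + 1)
    have h9 := mul_le_mul_of_nonneg_left h7 h4.le
    nlinarith
  have hm : 1 / (Fintype.card V : ℝ) * Fintype.card V = 1 := by field_simp
  have hm0 : 0 < 1 / (Fintype.card V : ℝ) := by positivity
  have hm1 : 1 / (Fintype.card V : ℝ) ≤ 1 / 59 := one_div_le_one_div_of_le (by norm_num) h1
  set u := 1 / (ρ + 1)
  set N := (Fintype.card V : ℝ)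
  set m := 1 / N
  set e := N - 3 - ρ with he
  have hN : ρ + 1 = N - 2 - e := by rw [he]; ring
  -- Here u = 1/(N - 2 - e) with e ≤ 2m expands as m + 2m² + 6m³ + …; the coefficient 6.5 absorbs
  -- the tail.
  have hu : u ≤ m + 2 * m ^ 2 + 6.5 * m ^ 3 := by
    have h6 : 1 ≤ (m + 2 * m ^ 2 + 6.5 * m ^ 3) * (ρ + 1) := by
      have h7 : (m + 2 * m ^ 2 + 6.5 * m ^ 3) * (N - 2 - 2 * m) ≤
          (m + 2 * m ^ 2 + 6.5 * m ^ 3) * (ρ + 1) := by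
        refine mul_le_mul_of_nonneg_left ?_ (by positivity)
        nlinarith [pow_pos hm0 3]
      refine le_trans ?_ h7
      have h8 : (m + 2 * m ^ 2 + 6.5 * m ^ 3) * (N - 2 - 2 * m) =
        (m * N) + 2 * m * (m * N) + 6.5 * m ^ 2 * (m * N) -
          (m + 2 * m ^ 2 + 6.5 * m ^ 3) * (2 + 2 * m) := by ring
      rw [h8, hm]
      have h9 : 0 ≤ m ^ 2 * (0.5 - 17 * m - 13 * m ^ 2) :=
        mul_nonneg (by positivity) (by nlinarith)
      nlinarith
    exact le_of_mul_le_mul_right (h5.le.trans h6) (by linarith [h.rho_ge])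
  have hu' : u ≤ 1.04 * m := by nlinarith
  have hu3 : u ^ 3 ≤ 1.2 * m ^ 3 := by
    calc u ^ 3 ≤ (1.04 * m) ^ 3 := pow_le_pow_left₀ h4.le hu' 3
      _ ≤ 1.2 * m ^ 3 := by
        rw [mul_pow]
        exact mul_le_mul_of_nonneg_right (by norm_num) (by positivity)
  have hu4 : u ^ 4 ≤ u ^ 3 * (1 / 56) := by
    rw [pow_succ]
    exact mul_le_mul_of_nonneg_left h4' (by positivity)
  have hup : e * (ρ + 3) ≤ 2 - 4 * m - 12 * m ^ 2 + 17 * m ^ 3 := by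
    have h6 : ρ + 3 = N - e := by rw [he]; ring
    rw [h6]
    set e0 := 2 * m - 4 * m ^ 2 - 8 * m ^ 3 with he0
    have he1 : 0 ≤ e := by rw [he]; linarith
    have he2 : e0 ≤ 1 := by nlinarith [pow_pos hm0 3, pow_pos hm0 2]
    -- The function e(N - e) increases for e below N/2, so e may be replaced by its upper bound
    -- `e0`.
    have h7 : e * (N - e) ≤ e0 * (N - e0) := by nlinarith
    refine h7.trans ?_
    have h8 : e0 * (N - e0) = 2 * (m * N) - 4 * m * (m * N) - 8 * m ^ 2 * (m * N) - e0 ^ 2 := by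
      rw [he0]; ring
    rw [h8, hm]
    have h9 : 0 ≤ m ^ 3 * (1 - 16 * m + 64 * m ^ 2 + 64 * m ^ 3) :=
      mul_nonneg (by positivity) (by linarith [pow_pos hm0 3, pow_pos hm0 2])
    rw [he0]
    linarith
  -- Twice the entry at a is at least 2 - 4m - 8m² up to order m³, while e(ρ + 3) is at most 2 - 4m
  -- - 12m² + 17m³. The difference 4m² dominates the cubic errors.
  have h10 : 0 < m ^ 2 * (4 - 100 * m) := mul_pos (by positivity) (by linarith)
  push_cast at hsum
  linarith [pow_pos hm0 3]

/-- This is used with s = ρ + 1, t = 1/s, m = 1/n and e the gap; `h1` is the eigenvalue equation at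
the vertex of degree 2 once its neighbors have total entry at least 2(1 - t²). It forces e ≥ 2t -
8t² + 14t³ - …, whereas the assumed bound on e expands as 2t - 8t² + 12t³ + …, so the contradiction
is of order t³. -/
theorem gap_ge_of_nonadj_neighbors {t e m s : ℝ} (ht0 : 0 < t) (ht : t ≤ 1 / 56) (hts : t * s = 1)
    (h1 : (s - 3 + e) * (2 * (1 - t ^ 2)) ≤ (s - 1) * (e * (s + 2)))
    (hm0 : 0 < m) (hms : m * (s + 2 + e) = 1) (he : e ≤ 2 * m - 4 * m ^ 2 - 8 * m ^ 3) :
    False := by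
  have h2 : 2 * (t - 3 * t ^ 2 + e * t ^ 2) * (1 - t ^ 2) ≤ e * (1 + t - 2 * t ^ 2) := by
    have h3 := mul_le_mul_of_nonneg_left h1 (sq_nonneg t)
    have h4 : t ^ 2 * ((s - 3 + e) * (2 * (1 - t ^ 2))) =
      2 * (t * (t * s) - 3 * t ^ 2 + e * t ^ 2) * (1 - t ^ 2) := by ring
    have h5 : t ^ 2 * ((s - 1) * (e * (s + 2))) =
      e * ((t * s) ^ 2 + t * (t * s) - 2 * t ^ 2) := by ring
    rw [h4, h5, hts] at h3
    linarith
  have ht2 : 0 < t ^ 2 := by positivity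
  have ht4 : 0 < t ^ 4 := by positivity
  have hlow : 2 * t - 8 * t ^ 2 + 14 * t ^ 3 - 41 * t ^ 4 ≤ e := by
    by_contra h3
    push Not at h3
    have h4 : 0 < 1 + t - 4 * t ^ 2 + 2 * t ^ 4 := by nlinarith
    have h5 := mul_lt_mul_of_pos_right h3 h4
    have h6 : 0 ≤ t ^ 4 * (1 + 93 * t - 148 * t ^ 2 - 28 * t ^ 3 + 82 * t ^ 4) :=
      mul_nonneg ht4.le (by nlinarith [pow_pos ht0 3, mul_pos ht0 ht2])
    nlinarith
  have hM : m ≤ t - 2 * t ^ 2 + 2 * t ^ 3 + 9 * t ^ 4 := by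
    have h3 : m * (1 + 2 * t + e * t) = t := by
      have : t * (m * (s + 2 + e)) = m * (t * s + 2 * t + e * t) := by ring
      rw [hms, hts] at this
      linarith
    have h4 : t * (2 * t - 8 * t ^ 2 + 13 * t ^ 3) ≤ e * t := by
      have : 0 ≤ t ^ 3 * (1 - 41 * t) := mul_nonneg (by positivity) (by linarith)
      nlinarith
    by_contra h5
    push Not at h5
    have h6 : 0 < t - 2 * t ^ 2 + 2 * t ^ 3 + 9 * t ^ 4 := by
      nlinarith [pow_pos ht0 3]
    have h7 : 0 < 1 + 2 * t + (2 * t ^ 2 - 8 * t ^ 3 + 13 * t ^ 4) := by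
      nlinarith [pow_pos ht0 3]
    have h8 : m * (1 + 2 * t + (2 * t ^ 2 - 8 * t ^ 3 + 13 * t ^ 4)) ≤ t :=
      (mul_le_mul_of_nonneg_left (by linarith) hm0.le).trans h3.le
    have h9 := mul_lt_mul_of_pos_right h5 h7
    have h10 : 0 ≤ t ^ 4 * (1 + 51 * t - 24 * t ^ 2 - 46 * t ^ 3 + 117 * t ^ 4) :=
      mul_nonneg ht4.le (by nlinarith [pow_pos ht0 3, mul_pos ht0 ht2])
    nlinarith
  set M := t - 2 * t ^ 2 + 2 * t ^ 3 + 9 * t ^ 4 with hMdef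
  have hM1 : M ≤ 0.02 := by
    have : t ^ 3 ≤ t ^ 2 * (1 / 56) := by
      rw [pow_succ]; exact mul_le_mul_of_nonneg_left ht ht2.le
    have : t ^ 4 ≤ t ^ 2 * (1 / 56) := by nlinarith
    nlinarith
  have hmono : 2 * m - 4 * m ^ 2 - 8 * m ^ 3 ≤ 2 * M - 4 * M ^ 2 - 8 * M ^ 3 := by
    have : 0 ≤ (M - m) * (2 - 4 * (M + m) - 8 * (M ^ 2 + M * m + m ^ 2)) :=
      mul_nonneg (by linarith) (by nlinarith)
    nlinarith
  have h3 : t - 2 * t ^ 2 + 2 * t ^ 3 ≤ M := by rw [hMdef]; linarith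
  have h4 : 0 ≤ t - 2 * t ^ 2 := by nlinarith
  have h5 : (t - 2 * t ^ 2 + 2 * t ^ 3) ^ 2 ≤ M ^ 2 :=
    pow_le_pow_left₀ (by linarith [pow_pos ht0 3]) h3 2
  have h6 : (t - 2 * t ^ 2) ^ 3 ≤ M ^ 3 :=
    pow_le_pow_left₀ h4 (by linarith [pow_pos ht0 3]) 3
  have h7 : 0 < t ^ 3 * (2 - 75 * t + 64 * t ^ 2 - 64 * t ^ 3) :=
    mul_pos (by positivity) (by nlinarith [pow_pos ht0 3])
  nlinarith

/-- A single deficient vertex of degree `2` has adjacent neighbors if the gap is small. -/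
theorem adj_of_single_degree_two (h : NormalizedPerron G ρ x) {a v w : V}
    (hfull : ∀ i ≠ a, defect G i = 0) (hvw : v ≠ w) (hN : G.neighborFinset a = {v, w})
    (hgap : Fintype.card V - 3 - ρ ≤ 2 * (1 / (Fintype.card V : ℝ)) -
      4 * (1 / (Fintype.card V : ℝ)) ^ 2 - 8 * (1 / (Fintype.card V : ℝ)) ^ 3) : G.Adj v w := by
  by_contra hadj
  have hmem : ∀ i, G.Adj a i ↔ i = v ∨ i = w := by
    intro i
    rw [← SimpleGraph.mem_neighborFinset, hN]
    simp
  have hav := (hmem v).2 (Or.inl rfl)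
  have haw := (hmem w).2 (Or.inr rfl)
  have h4 := h.u_pos
  have h4' := h.u_le
  have h5 := h.u_mul
  -- The vertex v misses w and one more vertex q. As q misses v in turn, x q is bounded above in
  -- terms of x v, and `eq_coNeighbors` at v becomes a lower bound for x v. Adding the versions for
  -- v and w bounds the total in `hX`.
  have key : ∀ v w, v ≠ w → ¬ G.Adj v w → G.Adj a v → G.Adj a w →
      (∀ i, G.Adj a i → i = v ∨ i = w) →
      (ρ + 3) - x w - 1 / (ρ + 1) * ((ρ + 3) - x v) ≤ (ρ + 1) * x v := by
    intro v w hvw hadj hav haw hmem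
    have hw : w ∈ coNeighbors G v := mem_coNeighbors.2 ⟨hvw.symm, hadj⟩
    obtain ⟨q, hq⟩ : ∃ q, (coNeighbors G v).erase w = {q} := by
      rw [← Finset.card_eq_one, Finset.card_erase_of_mem hw, h.card_co, hfull v hav.ne']
    have hq' : q ∈ (coNeighbors G v).erase w := by simp [hq]
    rw [Finset.mem_erase, mem_coNeighbors] at hq'
    have h6 := h.eq_coNeighbors v
    rw [← Finset.add_sum_erase _ _ hw, hq, Finset.sum_singleton] at h6
    have h7 := h.eq_coNeighbors q
    have h8 : x v ≤ ∑ j ∈ coNeighbors G q, x j :=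
      Finset.single_le_sum (f := x) (fun i _ => h.nonneg i)
        (mem_coNeighbors.2 ⟨hq'.2.1.symm, fun hh => hq'.2.2 hh.symm⟩)
    have h9 : (1 / (ρ + 1)) * ((ρ + 1) * x q) = x q := by rw [← mul_assoc, h5, one_mul]
    rw [h7] at h9
    have h10 := mul_le_mul_of_nonneg_left
      (by linarith : ρ + 3 - ∑ j ∈ coNeighbors G q, x j ≤ ρ + 3 - x v) h4.le
    linarith
  have hk1 := key v w hvw hadj hav haw fun i => (hmem i).1
  have hk2 := key w v hvw.symm (fun hh => hadj hh.symm) haw hav fun i hi => ((hmem i).1 hi).symm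
  have hsum := h.sum_defect
  rw [h.sum_eq_single hfull, h.cast_defect, ← G.card_neighborFinset_eq_degree, hN,
    Finset.card_pair hvw] at hsum
  have hxa := h.eig a
  rw [hN, Finset.sum_pair hvw] at hxa
  have h1 := h.card_ge'
  have hX : 2 * (1 - (1 / (ρ + 1)) ^ 2) ≤ x v + x w := by
    set t := 1 / (ρ + 1)
    set X := x v + x w
    have h6 : 2 * (ρ + 3) * (1 - t) ≤ (ρ + 1 + 1 - t) * X := by
      simp only [X]
      nlinarith
    have h7 := mul_le_mul_of_nonneg_left h6 h4.le
    have h8 : t * (2 * (ρ + 3) * (1 - t)) = 2 * (t * (ρ + 1) + 2 * t) * (1 - t) := by ring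
    have h9 : t * ((ρ + 1 + 1 - t) * X) = (t * (ρ + 1) + t - t ^ 2) * X := by ring
    rw [h8, h9, h5] at h7
    by_contra h10
    push Not at h10
    have h11 := mul_lt_mul_of_pos_left h10 (by nlinarith : 0 < 1 + t - t ^ 2)
    have h12 : 0 ≤ t ^ 3 * (1 - t) := mul_nonneg (by positivity) (by linarith)
    nlinarith
  refine gap_ge_of_nonadj_neighbors (s := ρ + 1) (e := Fintype.card V - 3 - ρ)
    (m := 1 / (Fintype.card V : ℝ)) h4 h4' h5 ?_ (by positivity) ?_ hgap
  · have h6 : (ρ + 1 - 1) * ((Fintype.card V - 3 - ρ) * (ρ + 1 + 2)) =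
        (Fintype.card V - 5) * (ρ * x a) := by
      rw [show ρ + 1 + 2 = ρ + 3 by ring, ← hsum]
      push_cast
      ring
    rw [h6, ← hxa, show ρ + 1 - 3 + ((Fintype.card V : ℝ) - 3 - ρ) = Fintype.card V - 5 by ring]
    exact mul_le_mul_of_nonneg_left hX (by linarith)
  · rw [show ρ + 1 + 2 + ((Fintype.card V : ℝ) - 3 - ρ) = Fintype.card V by ring]
    field_simp

end NormalizedPerron

theorem exists_normalizedPerron {V : Type*} [Fintype V] {G : SimpleGraph V} {lam : ℝ}
    (hcard : 59 ≤ Fintype.card V) (hdeg : ∀ i, G.degree i + 3 ≤ Fintype.card V)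
    (hgap : (Fintype.card V - 3 - lam) * Fintype.card V ≤ 2)
    (hG : ENNReal.ofReal lam ≤ graphSpectralRadius G) :
    ∃ ρ x, lam ≤ ρ ∧ NormalizedPerron G ρ x := by
  have : Nonempty V := by
    rw [← Fintype.card_pos_iff]
    omega
  obtain ⟨ρ, hρ0, hρ, -, y, hy0, hyne, hy⟩ := exists_perron G
  rw [hρ, ENNReal.ofReal_le_ofReal_iff hρ0] at hG
  have hpos : 0 < ∑ i, y i := by
    obtain ⟨i, hi⟩ := Function.ne_iff.1 hyne
    exact Finset.sum_pos' (fun i _ => hy0 i)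
      ⟨i, Finset.mem_univ _, lt_of_le_of_ne (hy0 i) (Ne.symm hi)⟩
  refine ⟨ρ, fun i => (ρ + 3) / (∑ i, y i) * y i, hG, hcard, hdeg, ?_, ?_, ?_, ?_⟩
  · intro i
    have := hy0 i
    positivity
  · rw [← Finset.mul_sum]
    field_simp
  · intro i
    have h1 := congrFun hy i
    rw [SimpleGraph.adjMatrix_mulVec_apply] at h1
    rw [← Finset.mul_sum, h1]
    simp only [Pi.smul_apply, smul_eq_mul]
    ring
  · refine le_trans ?_ hgap
    have : (0 : ℝ) ≤ Fintype.card V := Nat.cast_nonneg _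
    nlinarith

theorem IsConnectedNonregular.degree_add_le {V : Type*} [Fintype V] {n : ℕ} {G : SimpleGraph V}
    (hG : IsConnectedNonregular n (n - 3) G) (hn : 59 ≤ n) (i : V) :
    G.degree i + 3 ≤ Fintype.card V := by
  have h1 := G.degree_le_maxDegree i
  rw [hG.maxDegree] at h1
  rw [hG.order]
  omega

theorem IsConnectedNonregular.exists_defect_ne {V : Type*} [Fintype V] {n : ℕ} {G : SimpleGraph V}
    (hG : IsConnectedNonregular n (n - 3) G) (hn : 59 ≤ n) : ∃ i, defect G i ≠ 0 := by
  by_contra h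
  push Not at h
  refine hG.nonregular ⟨n - 3, fun i => ?_⟩
  have h1 := hG.degree_add_le hn i
  have h2 := h i
  unfold defect at h2
  rw [hG.order] at h1 h2
  convert (by omega : G.degree i = n - 3)

/-- The degree sum is even. For even n this makes the exceptional degree odd, and for odd n even. -/
theorem even_degree_add {V : Type*} [Fintype V] {n : ℕ} {G : SimpleGraph V} {a : V}
    (hn : Fintype.card V = n) (h : ∀ i ≠ a, G.degree i = n - 3) :
    Even (G.degree a + (n - 1) * (n - 3)) := by
  have h1 := G.sum_degrees_eq_twice_card_edges
  rw [← Finset.add_sum_erase _ _ (Finset.mem_univ a),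
    Finset.sum_congr rfl fun i hi => h i (Finset.ne_of_mem_erase hi), Finset.sum_const,
    Finset.card_erase_of_mem (Finset.mem_univ a), Finset.card_univ, hn, smul_eq_mul] at h1
  rw [h1]
  exact even_two_mul _

theorem exists_pendant_of_even {V : Type*} [Fintype V] {n : ℕ} {G : SimpleGraph V} (hn : 59 ≤ n)
    (he : Even n) (hG : IsConnectedNonregular n (n - 3) G)
    (hρ : ENNReal.ofReal (n - 3 - 1 / (n - 1)) ≤ graphSpectralRadius G) :
    ∃ a, G.degree a = 1 ∧ ∀ i ≠ a, G.degree i = n - 3 := by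
  have hcard := hG.order
  have hn' : (59 : ℝ) ≤ n := by exact_mod_cast hn
  have h1 : 1 / ((n : ℝ) - 1) ≤ 1 / 58 := one_div_le_one_div_of_le (by norm_num) (by linarith)
  have h2 : 1 / ((n : ℝ) - 1) * (n - 1) = 1 := by
    have : (n : ℝ) - 1 ≠ 0 := by linarith
    field_simp
  obtain ⟨ρ, x, hlam, h⟩ := exists_normalizedPerron (G := G) (lam := n - 3 - 1 / (n - 1))
    (by rwa [hcard]) (hG.degree_add_le hn) (by rw [hcard]; nlinarith) hρ
  -- The gap is at most 1/(n - 1), and n/(n - 1) ≤ 59/58 < 1.02.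
  have hgap : ((n : ℝ) - 3 - ρ) * n ≤ 1.02 := by nlinarith
  have h3 : 1 / (n : ℝ) ≤ 1 / 59 := one_div_le_one_div_of_le (by norm_num) hn'
  have hD := h.sum_le_of_gap (by rw [hcard]; linarith)
  obtain ⟨a, ha, hfull⟩ := h.trichotomy hD hG.connected (hG.exists_defect_ne hn)
  have hdeg : ∀ i ≠ a, G.degree i = n - 3 := fun i hi => by
    rw [← hcard]
    exact (h.degree_eq_iff i).2 (hfull i hi)
  refine ⟨a, ?_, hdeg⟩
  rcases ha with ha | ha | ha
  · exact ha
  · exfalso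
    have h4 := even_degree_add hcard hdeg
    rw [ha, Nat.even_add, Nat.even_mul, Nat.even_sub (by omega), Nat.even_sub (by omega)] at h4
    simp [he, (by decide : ¬ Even 3)] at h4
  -- Parity allows defect 2 here, but twice an entry close to 1 exceeds 1.02.
  · exfalso
    have h4 := h.sum_defect
    rw [h.sum_eq_single hfull, ha, hcard] at h4
    have h5 := h.ge_u a
    rw [ha] at h5
    have h6 := h.rho_le
    rw [hcard] at h6
    have h7 := h.u_le
    have h8 := h.u_pos
    push_cast at h4 h5
    set u := 1 / (ρ + 1)
    nlinarith

theorem exists_triangle_of_odd {V : Type*} [Fintype V] {n : ℕ} {G : SimpleGraph V} (hn : 59 ≤ n)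
    (ho : Odd n) (hG : IsConnectedNonregular n (n - 3) G)
    (hρ : ENNReal.ofReal (n - 3 - (2 * (1 / (n : ℝ)) - 4 * (1 / (n : ℝ)) ^ 2 -
      8 * (1 / (n : ℝ)) ^ 3)) ≤ graphSpectralRadius G) :
    ∃ a v w, v ≠ w ∧ G.neighborFinset a = {v, w} ∧ G.Adj v w ∧ ∀ i ≠ a, G.degree i = n - 3 := by
  have hcard := hG.order
  have hn' : (59 : ℝ) ≤ n := by exact_mod_cast hn
  have h1 : 1 / (n : ℝ) ≤ 1 / 59 := one_div_le_one_div_of_le (by norm_num) hn'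
  have h2 : 1 / (n : ℝ) * n = 1 := by field_simp
  have h0 : 0 < 1 / (n : ℝ) := by positivity
  have hlin : (2 * (1 / (n : ℝ)) - 4 * (1 / (n : ℝ)) ^ 2 - 8 * (1 / (n : ℝ)) ^ 3) * n ≤
      2 - 4 * (1 / (n : ℝ)) := by
    have : (2 * (1 / (n : ℝ)) - 4 * (1 / (n : ℝ)) ^ 2 - 8 * (1 / (n : ℝ)) ^ 3) * n =
      2 * (1 / (n : ℝ) * n) - 4 * (1 / (n : ℝ)) * (1 / (n : ℝ) * n) -
        8 * (1 / (n : ℝ)) ^ 2 * (1 / (n : ℝ) * n) := by ring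
    rw [this, h2]
    nlinarith
  obtain ⟨ρ, x, hlam, h⟩ := exists_normalizedPerron (G := G)
    (by rwa [hcard]) (hG.degree_add_le hn)
    (by rw [hcard]; nlinarith) hρ
  have hgap : (n : ℝ) - 3 - ρ ≤ 2 * (1 / (n : ℝ)) - 4 * (1 / (n : ℝ)) ^ 2 -
      8 * (1 / (n : ℝ)) ^ 3 := by linarith
  have hD := h.sum_le_of_gap (by
    rw [hcard]
    exact (mul_le_mul_of_nonneg_right hgap (by linarith)).trans hlin)
  obtain ⟨a, ha, hfull⟩ := h.trichotomy hD hG.connected (hG.exists_defect_ne hn)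
  have hdeg : ∀ i ≠ a, G.degree i = n - 3 := fun i hi => by
    rw [← hcard]
    exact (h.degree_eq_iff i).2 (hfull i hi)
  rcases ha with ha | ha | ha
  · exfalso
    have h4 := even_degree_add hcard hdeg
    rw [ha, Nat.even_add, Nat.even_mul, Nat.even_sub (by omega), Nat.even_sub (by omega)] at h4
    simp [Nat.not_even_iff_odd.2 ho, (by decide : ¬ Even 3)] at h4
  · obtain ⟨v, w, hvw, hN⟩ := Finset.card_eq_two.1 ((G.card_neighborFinset_eq_degree a).trans ha)
    exact ⟨a, v, w, hvw, hN,
      h.adj_of_single_degree_two hfull hvw hN (by rw [hcard]; exact hgap), hdeg⟩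
  · exact (h.not_single_defect_two ha hfull (by rw [hcard]; exact hgap)).elim

end Structure

/-! ### The graphs `H1` and `H2`: degrees, connectedness and test vectors -/

section Graphs
open Classical

theorem sum_neighborFinset {V M : Type*} [Fintype V] [AddCommMonoid M] (G : SimpleGraph V) (i : V)
    (f : V → M) : ∑ j ∈ G.neighborFinset i, f j = ∑ j, if G.Adj i j then f j else 0 := by
  rw [← Finset.sum_filter]
  congr 1
  ext j
  simp

theorem degree_eq_sum {V : Type*} [Fintype V] (G : SimpleGraph V) (i : V) :
    G.degree i = ∑ j, if G.Adj i j then 1 else 0 := by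
  rw [← sum_neighborFinset, Finset.sum_const, smul_eq_mul, mul_one,
    G.card_neighborFinset_eq_degree]

theorem ofReal_le_graphSpectralRadius {V : Type*} [Fintype V] (G : SimpleGraph V) (z : V → ℝ)
    {lam : ℝ} (hz : 0 < ∑ i, z i * z i)
    (h : lam * ∑ i, z i * z i ≤ ∑ i, z i * ∑ j, if G.Adj i j then z j else 0) :
    ENNReal.ofReal lam ≤ graphSpectralRadius G := by
  have : Nonempty V := by
    by_contra hne
    rw [not_nonempty_iff] at hne
    simp at hz
  obtain ⟨ρ, -, hρ, hmax, -⟩ := exists_perron G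
  rw [hρ]
  refine ENNReal.ofReal_le_ofReal (le_of_mul_le_mul_right (h.trans ?_) hz)
  have := hmax z
  simp only [dotProduct, SimpleGraph.adjMatrix_mulVec_apply, sum_neighborFinset] at this
  exact this

theorem completeMinusMatching_adj {t : ℕ} {i j : Fin t} :
    (completeMinusMatching t).Adj i j ↔ i.val / 2 ≠ j.val / 2 := by
  simp only [completeMinusMatching, pairMatching, SimpleGraph.sdiff_adj, SimpleGraph.top_adj]
  constructor
  · tauto
  · intro h
    have : i ≠ j := by
      rintro rfl
      exact h rfl
    tauto

theorem card_completeMinusMatching {t : ℕ} (ht : Even t) (i : Fin t) :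
    (Finset.univ.filter fun j => (completeMinusMatching t).Adj i j).card = t - 2 := by
  obtain ⟨k, hk⟩ := ht
  have hi := i.2
  have h1 : (Finset.univ.filter fun j => ¬ (completeMinusMatching t).Adj i j) =
      {⟨2 * (i.val / 2), by omega⟩, ⟨2 * (i.val / 2) + 1, by omega⟩} := by
    ext j
    simp only [Finset.mem_filter, Finset.mem_univ, true_and, Finset.mem_insert,
      Finset.mem_singleton, completeMinusMatching_adj, Fin.ext_iff]
    omega
  have h2 := Finset.card_filter_add_card_filter_not (s := (Finset.univ : Finset (Fin t)))
    (fun j => (completeMinusMatching t).Adj i j)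
  rw [h1, Finset.card_pair (by simp), Finset.card_univ, Fintype.card_fin] at h2
  omega

theorem IsConnectedNonregular.of_degrees {V : Type*} [Fintype V] {G : SimpleGraph V} {n : ℕ}
    (hcard : Fintype.card V = n) (hc : G.Connected) {a b : V}
    (ha : G.degree a < n - 3) (hb : G.degree b = n - 3) (hle : ∀ i, G.degree i ≤ n - 3) :
    IsConnectedNonregular n (n - 3) G := by
  refine ⟨hcard, hc, ?_, ?_⟩
  · rintro ⟨d, hd⟩
    have h1 : G.degree a = d := by convert hd a
    have h2 : G.degree b = d := by convert hd b
    omega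
  · refine le_antisymm (G.maxDegree_le_of_forall_degree_le _ hle) ?_
    rw [← hb]
    exact G.degree_le_maxDegree b

/-- The vertices of `H1 n` as a sum type. -/
def h1VertexEquiv (n : ℕ) : Option (Option (Fin (n - 4) ⊕ Fin 2)) ≃ H1Vertex n where
  toFun
    | none => .u
    | some none => .v
    | some (some (.inl i)) => .V1 i
    | some (some (.inr i)) => .V2 i
  invFun
    | .u => none
    | .v => some none
    | .V1 i => some (some (.inl i))
    | .V2 i => some (some (.inr i))
  left_inv := by rintro (_ | _ | _ | _) <;> rfl
  right_inv := by rintro (_ | _ | _ | _) <;> rfl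

noncomputable instance (n : ℕ) : Fintype (H1Vertex n) := Fintype.ofEquiv _ (h1VertexEquiv n)

theorem sum_h1Vertex {M : Type*} [AddCommMonoid M] (n : ℕ) (f : H1Vertex n → M) :
    ∑ i, f i = f .u + (f .v + (∑ i, f (.V1 i) + (f (.V2 0) + f (.V2 1)))) := by
  rw [← (h1VertexEquiv n).sum_comp, Fintype.sum_option, Fintype.sum_option, Fintype.sum_sum_type,
    Fin.sum_univ_two]
  rfl

theorem card_h1Vertex {n : ℕ} (hn : 4 ≤ n) : Fintype.card (H1Vertex n) = n := by
  rw [← Fintype.card_congr (h1VertexEquiv n)]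
  simp
  omega

/-- The vertices of `H2 n` as a sum type. -/
def h2VertexEquiv (n : ℕ) :
    Option (Option (Option (Fin 2 ⊕ Fin 2 ⊕ Fin (n - 7)))) ≃ H2Vertex n where
  toFun
    | none => .u
    | some none => .v1
    | some (some none) => .v2
    | some (some (some (.inl i))) => .V1 i
    | some (some (some (.inr (.inl i)))) => .V2 i
    | some (some (some (.inr (.inr i)))) => .V3 i
  invFun
    | .u => none
    | .v1 => some none
    | .v2 => some (some none)
    | .V1 i => some (some (some (.inl i)))
    | .V2 i => some (some (some (.inr (.inl i))))
    | .V3 i => some (some (some (.inr (.inr i))))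
  left_inv := by rintro (_ | _ | _ | _ | _ | _) <;> rfl
  right_inv := by rintro (_ | _ | _ | _ | _ | _) <;> rfl

noncomputable instance (n : ℕ) : Fintype (H2Vertex n) := Fintype.ofEquiv _ (h2VertexEquiv n)

theorem sum_h2Vertex {M : Type*} [AddCommMonoid M] (n : ℕ) (f : H2Vertex n → M) :
    ∑ i, f i = f .u + (f .v1 + (f .v2 + ((f (.V1 0) + f (.V1 1)) + ((f (.V2 0) + f (.V2 1)) +
      ∑ i, f (.V3 i))))) := by
  rw [← (h2VertexEquiv n).sum_comp, Fintype.sum_option, Fintype.sum_option, Fintype.sum_option,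
    Fintype.sum_sum_type, Fintype.sum_sum_type, Fin.sum_univ_two, Fin.sum_univ_two]
  rfl

theorem card_h2Vertex {n : ℕ} (hn : 7 ≤ n) : Fintype.card (H2Vertex n) = n := by
  rw [← Fintype.card_congr (h2VertexEquiv n)]
  simp
  omega

/-- The neighbor sums of `H1 n` for a function that is constant on the parts. -/
theorem h1_sum {M : Type*} [AddCommMonoid M] {n : ℕ} (hn : Even n) (hn6 : 6 ≤ n)
    (f : H1Vertex n → M) {c d : M} (h1 : ∀ i, f (.V1 i) = c) (h2 : ∀ i, f (.V2 i) = d) :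
    (∑ j, if (H1 n).Adj .u j then f j else 0) = f .v ∧
    (∑ j, if (H1 n).Adj .v j then f j else 0) = f .u + (n - 4) • c ∧
    (∀ i, (∑ j, if (H1 n).Adj (.V1 i) j then f j else 0) = f .v + ((n - 6) • c + (d + d))) ∧
    ∀ i, (∑ j, if (H1 n).Adj (.V2 i) j then f j else 0) = (n - 4) • c + d := by
  have he : Even (n - 4) := by
    rw [Nat.even_sub (by omega)]
    exact iff_of_true hn (by decide)
  refine ⟨?_, ?_, fun i => ?_, fun i => ?_⟩ <;> rw [sum_h1Vertex]
  · simp [H1]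
  · simp [H1, h1]
  · have h3 : ∀ j, ((H1 n).Adj (.V1 i) (.V1 j) ↔ (completeMinusMatching (n - 4)).Adj i j) := by
      intro j
      simp only [H1, SimpleGraph.fromRel_adj, (completeMinusMatching (n - 4)).adj_comm j i, or_self,
        ne_eq, H1Vertex.V1.injEq, and_iff_right_iff_imp]
      exact fun h => h.ne
    simp only [h3, h1, h2]
    rw [← Finset.sum_filter, Finset.sum_const, card_completeMinusMatching he,
      show n - 4 - 2 = n - 6 by omega]
    simp [H1]
  · fin_cases i <;> simp [H1, h1, h2]

/-- The neighbor sums of `H2 n` for a function that is constant on the parts. -/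
theorem h2_sum {M : Type*} [AddCommMonoid M] {n : ℕ} (hn : Odd n) (hn9 : 9 ≤ n)
    (f : H2Vertex n → M) {b c d : M} (hv1 : f .v1 = b) (hv2 : f .v2 = b)
    (h1 : ∀ i, f (.V1 i) = c) (h2 : ∀ i, f (.V2 i) = c) (h3 : ∀ i, f (.V3 i) = d) :
    (∑ j, if (H2 n).Adj .u j then f j else 0) = b + b ∧
    (∑ j, if (H2 n).Adj .v1 j then f j else 0) = f .u + (b + ((c + c) + (n - 7) • d)) ∧
    (∑ j, if (H2 n).Adj .v2 j then f j else 0) = f .u + (b + ((c + c) + (n - 7) • d)) ∧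
    (∀ i, (∑ j, if (H2 n).Adj (.V1 i) j then f j else 0) = b + (c + ((c + c) + (n - 7) • d))) ∧
    (∀ i, (∑ j, if (H2 n).Adj (.V2 i) j then f j else 0) = b + ((c + c) + (c + (n - 7) • d))) ∧
    ∀ i, (∑ j, if (H2 n).Adj (.V3 i) j then f j else 0) =
      b + (b + ((c + c) + ((c + c) + (n - 9) • d))) := by
  have he : Even (n - 7) := by
    rw [Nat.even_sub (by omega)]
    exact iff_of_false (Nat.not_even_iff_odd.2 hn) (by decide)
  refine ⟨?_, ?_, ?_, fun i => ?_, fun i => ?_, fun i => ?_⟩ <;> rw [sum_h2Vertex]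
  · simp [H2, hv1, hv2]
  · simp [H2, hv2, h1, h3]
  · simp [H2, hv1, h2, h3]
  · fin_cases i <;> simp [H2, hv1, h1, h2, h3]
  · fin_cases i <;> simp [H2, hv2, h1, h2, h3]
  · have h4 : ∀ j, ((H2 n).Adj (.V3 i) (.V3 j) ↔ (completeMinusMatching (n - 7)).Adj i j) := by
      intro j
      simp only [H2, SimpleGraph.fromRel_adj, (completeMinusMatching (n - 7)).adj_comm j i, or_self,
        ne_eq, H2Vertex.V3.injEq, and_iff_right_iff_imp]
      exact fun h => h.ne
    simp only [h4, h1, h2, h3, hv1, hv2]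
    rw [← Finset.sum_filter, Finset.sum_const, card_completeMinusMatching he,
      show n - 7 - 2 = n - 9 by omega]
    simp [H2]

theorem h1_degree {n : ℕ} (hn : Even n) (hn6 : 6 ≤ n) :
    (H1 n).degree .u = 1 ∧ ∀ i, i ≠ .u → (H1 n).degree i = n - 3 := by
  obtain ⟨h1, h2, h3, h4⟩ := h1_sum hn hn6 (fun _ => 1) (c := 1) (d := 1) (fun _ => rfl)
    (fun _ => rfl)
  refine ⟨?_, ?_⟩
  · rw [degree_eq_sum, h1]
  · rintro (_ | _ | i | i) hi
    · exact absurd rfl hi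
    · rw [degree_eq_sum, h2, smul_eq_mul]; omega
    · rw [degree_eq_sum, h3, smul_eq_mul]; omega
    · rw [degree_eq_sum, h4, smul_eq_mul]; omega

theorem h2_degree {n : ℕ} (hn : Odd n) (hn9 : 9 ≤ n) :
    (H2 n).degree .u = 2 ∧ ∀ i, i ≠ .u → (H2 n).degree i = n - 3 := by
  obtain ⟨h1, h2, h3, h4, h5, h6⟩ := h2_sum hn hn9 (fun _ => 1) (b := 1) (c := 1) (d := 1) rfl rfl
    (fun _ => rfl) (fun _ => rfl) (fun _ => rfl)
  refine ⟨?_, ?_⟩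
  · rw [degree_eq_sum, h1]
  · rintro (_ | _ | _ | i | i | i) hi
    · exact absurd rfl hi
    · rw [degree_eq_sum, h2, smul_eq_mul]; omega
    · rw [degree_eq_sum, h3, smul_eq_mul]; omega
    · rw [degree_eq_sum, h4, smul_eq_mul]; omega
    · rw [degree_eq_sum, h5, smul_eq_mul]; omega
    · rw [degree_eq_sum, h6, smul_eq_mul]; omega

theorem h1_isConnectedNonregular {n : ℕ} (hn : Even n) (hn6 : 6 ≤ n) :
    IsConnectedNonregular n (n - 3) (H1 n) := by
  obtain ⟨h1, h2⟩ := h1_degree hn hn6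
  refine .of_degrees (a := .u) (b := .v) (card_h1Vertex (by omega)) ?_ (by omega)
    (h2 _ (by simp)) ?_
  · refine SimpleGraph.connected_iff_exists_forall_reachable _ |>.2 ⟨.v, ?_⟩
    have h3 : ∀ i, (H1 n).Reachable .v (.V1 i) := fun i =>
      SimpleGraph.Adj.reachable (by simp [H1])
    rintro (_ | _ | i | i)
    · exact SimpleGraph.Adj.reachable (by simp [H1])
    · exact SimpleGraph.Reachable.refl _
    · exact h3 i
    · exact (h3 ⟨0, by omega⟩).trans (SimpleGraph.Adj.reachable (by simp [H1]))
  · intro i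
    by_cases hi : i = .u
    · rw [hi]; omega
    · exact (h2 i hi).le

theorem h2_isConnectedNonregular {n : ℕ} (hn : Odd n) (hn9 : 9 ≤ n) :
    IsConnectedNonregular n (n - 3) (H2 n) := by
  obtain ⟨h1, h2⟩ := h2_degree hn hn9
  refine .of_degrees (a := .u) (b := .v1) (card_h2Vertex (by omega)) ?_ (by omega)
    (h2 _ (by simp)) ?_
  · refine SimpleGraph.connected_iff_exists_forall_reachable _ |>.2 ⟨.v1, ?_⟩
    have h3 : ∀ i, (H2 n).Reachable .v1 (.V3 i) := fun i =>
      SimpleGraph.Adj.reachable (by simp [H2])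
    rintro (_ | _ | _ | i | i | i)
    · exact SimpleGraph.Adj.reachable (by simp [H2])
    · exact SimpleGraph.Reachable.refl _
    · exact SimpleGraph.Adj.reachable (by simp [H2])
    · exact SimpleGraph.Adj.reachable (by simp [H2])
    · exact (h3 ⟨0, by omega⟩).trans (SimpleGraph.Adj.reachable (by simp [H2]))
    · exact h3 i
  · intro i
    by_cases hi : i = .u
    · rw [hi]; omega
    · exact (h2 i hi).le

/-- The Rayleigh quotient of the indicator of all vertices but the pendant one is (n² - 4n + 2)/(n -
1), exactly the stated bound. -/
theorem h1_spectralRadius_ge {n : ℕ} (hn : Even n) (hn6 : 6 ≤ n) :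
    ENNReal.ofReal (n - 3 - 1 / (n - 1)) ≤ graphSpectralRadius (H1 n) := by
  set z : H1Vertex n → ℝ := fun i => if i = .u then 0 else 1 with hz
  obtain ⟨h1, h2, h3, h4⟩ := h1_sum hn hn6 z (c := 1) (d := 1) (by simp [hz]) (by simp [hz])
  have hn' : (6 : ℝ) ≤ n := by exact_mod_cast hn6
  have hzz : ∑ i, z i * z i = n - 1 := by
    rw [sum_h1Vertex]
    simp [hz]
    rw [Nat.cast_sub (by omega)]
    push_cast
    ring
  have hzA : (∑ i, z i * ∑ j, if (H1 n).Adj i j then z j else 0) = n ^ 2 - 4 * n + 2 := by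
    rw [sum_h1Vertex, h1, h2, h4, h4]
    simp only [h3]
    simp [hz]
    rw [Nat.cast_sub (by omega), Nat.cast_sub (by omega)]
    push_cast
    ring
  refine ofReal_le_graphSpectralRadius _ z ?_ ?_
  · rw [hzz]; linarith
  · rw [hzz, hzA, sub_mul, one_div_mul_cancel (by linarith)]
    linarith

theorem h2_spectralRadius_ge {n : ℕ} (hn : Odd n) (hn9 : 9 ≤ n) :
    ENNReal.ofReal (n - 3 - (2 * (1 / (n : ℝ)) - 4 * (1 / (n : ℝ)) ^ 2 - 8 * (1 / (n : ℝ)) ^ 3)) ≤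
      graphSpectralRadius (H2 n) := by
  -- Up to scaling, the entries imitate the eigenvector: about 2/n at the vertex of degree 2, and
  -- about 1 - 1/n at its neighbors relative to all others.
  set z : H2Vertex n → ℝ := fun
    | .u => 2
    | .v1 => n - 1
    | .v2 => n - 1
    | _ => n with hz
  obtain ⟨h1, h2, h3, h4, h5, h6⟩ := h2_sum hn hn9 z (b := n - 1) (c := n) (d := n) rfl rfl
    (fun _ => rfl) (fun _ => rfl) (fun _ => rfl)
  have hn' : (9 : ℝ) ≤ n := by exact_mod_cast hn9
  have hzz : ∑ i, z i * z i = 4 + 2 * (n - 1) ^ 2 + 4 * n ^ 2 + (n - 7) * n ^ 2 := by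
    rw [sum_h2Vertex]
    simp [hz]
    rw [Nat.cast_sub (by omega)]
    push_cast
    ring
  have hzA : (∑ i, z i * ∑ j, if (H2 n).Adj i j then z j else 0) =
      4 * (n - 1) + 2 * (n - 1) * (n ^ 2 - 4 * n + 1) + 4 * n * (n ^ 2 - 3 * n - 1) +
        (n - 7) * n * (n ^ 2 - 3 * n - 2) := by
    rw [sum_h2Vertex, h1, h2, h3, h4, h4, h5, h5]
    simp only [h6]
    simp [hz]
    rw [Nat.cast_sub (by omega), Nat.cast_sub (by omega)]
    push_cast
    ring
  refine ofReal_le_graphSpectralRadius _ z ?_ ?_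
  · rw [hzz]; nlinarith
  · rw [hzz, hzA]
    have h7 : (n : ℝ) - 3 - (2 * (1 / (n : ℝ)) - 4 * (1 / (n : ℝ)) ^ 2 - 8 * (1 / (n : ℝ)) ^ 3) =
        (n ^ 4 - 3 * n ^ 3 - 2 * n ^ 2 + 4 * n + 8) / n ^ 3 := by
      field_simp
      ring
    rw [h7, div_mul_eq_mul_div, div_le_iff₀ (by positivity)]
    -- In terms of m = n - 9 the remaining polynomial inequality has nonnegative coefficients only.
    obtain ⟨m, hm⟩ : ∃ m : ℝ, (n : ℝ) = m + 9 := ⟨n - 9, by ring⟩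
    have hm0 : 0 ≤ m := by linarith
    rw [hm, ← sub_nonneg]
    ring_nf
    positivity

end Graphs

/-! ### Reconstructing the graph from its nonadjacencies -/

section Labeling
open Classical

/-- A set of vertices in which everyone misses exactly one other vertex induces a complete graph
minus a perfect matching. -/
theorem exists_labeling {V : Type*} [Fintype V] (G : SimpleGraph V) (S : Finset V) {t : ℕ}
    (ht : S.card = t) (hS : ∀ x ∈ S, ∃ y ∈ S, ∀ z ∈ S, z ∈ coNeighbors G x ↔ z = y) :
    ∃ e : Fin t → V, Function.Injective e ∧ (∀ i, e i ∈ S) ∧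
      ∀ i j, G.Adj (e i) (e j) ↔ (completeMinusMatching t).Adj i j := by
  choose! f hfS hf using hS
  have hff : ∀ x ∈ S, f (f x) = x := by
    intro x hx
    have h1 : f x ∈ coNeighbors G x := (hf x hx _ (hfS x hx)).2 rfl
    rw [mem_coNeighbors] at h1
    exact ((hf _ (hfS x hx) x hx).1 (mem_coNeighbors.2 ⟨h1.1.symm, fun h => h1.2 h.symm⟩)).symm
  have hfne : ∀ x ∈ S, f x ≠ x := fun x hx =>
    (mem_coNeighbors.1 ((hf x hx _ (hfS x hx)).2 rfl)).1
  -- The map f is a fixed-point-free involution of S. An arbitrary linear order picks one vertex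
  -- from each pair {x, f x}; these form `T`, and S is identified with `T × Fin 2`.
  let g := Fintype.equivFin V
  let T := S.filter fun x => g x < g (f x)
  have hT : ∀ x : T, x.1 ∈ S ∧ g x.1 < g (f x.1) := fun x => Finset.mem_filter.1 x.2
  let ψ : T × Fin 2 → V := fun p => if p.2 = 0 then p.1 else f p.1
  have hψS : ∀ p, ψ p ∈ S := by
    rintro ⟨x, b⟩
    simp only [ψ]
    split_ifs
    · exact (hT x).1
    · exact hfS _ (hT x).1
  have hnot : ∀ x y : T, (x : V) ≠ f y := by
    intro x y hxy
    have h1 := (hT x).2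
    rw [hxy, hff _ (hT y).1] at h1
    exact lt_asymm h1 (hT y).2
  have hψ : Function.Injective ψ := by
    rintro ⟨x, b⟩ ⟨y, c⟩ hxy
    fin_cases b <;> fin_cases c <;> simp [ψ] at hxy ⊢
    · exact hxy
    · exact (hnot _ _ hxy).elim
    · exact (hnot _ _ hxy.symm).elim
    · have := congrArg f hxy
      rw [hff _ (hT x).1, hff _ (hT y).1] at this
      exact Subtype.ext this
  have hfψ : ∀ p q, p ≠ q → (f (ψ p) = ψ q ↔ p.1 = q.1) := by
    rintro ⟨x, b⟩ ⟨y, c⟩ hpq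
    have hx := hff _ (hT x).1
    have h1 : (f x = f y ↔ x = y) := by
      refine ⟨fun h => ?_, fun h => by rw [h]⟩
      have := congrArg f h
      rw [hx, hff _ (hT y).1] at this
      exact Subtype.ext this
    fin_cases b <;> fin_cases c <;> simp [ψ, hx] at hpq ⊢
    · exact ⟨fun h => (hnot _ _ h.symm).elim, fun h => (hpq h).elim⟩
    · exact h1
    · exact ⟨fun h => (hnot _ _ h).elim, fun h => (hpq h).elim⟩
  have hcard : T.card * 2 = t := by
    rw [← ht]
    have h1 : (Finset.univ.image ψ) = S := by
      ext x
      simp only [Finset.mem_image, Finset.mem_univ, true_and]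
      constructor
      · rintro ⟨p, rfl⟩
        exact hψS p
      · intro hx
        by_cases hlt : g x < g (f x)
        · exact ⟨(⟨x, Finset.mem_filter.2 ⟨hx, hlt⟩⟩, 0), by simp [ψ]⟩
        · refine ⟨(⟨f x, Finset.mem_filter.2 ⟨hfS x hx, ?_⟩⟩, 1), by simp [ψ, hff x hx]⟩
          rw [hff x hx]
          exact lt_of_le_of_ne (not_lt.1 hlt) fun h => hfne x hx (g.injective h)
    rw [← h1, Finset.card_image_of_injective _ hψ, Finset.card_univ, Fintype.card_prod,
      Fintype.card_coe, Fintype.card_fin]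
  subst hcard
  -- Under `finProdFinEquiv` the pair containing i is i / 2, which matches `pairMatching`.
  let k : Fin (T.card * 2) ≃ T × Fin 2 :=
    finProdFinEquiv.symm.trans (Equiv.prodCongr T.equivFin.symm (Equiv.refl _))
  have hk : ∀ i j, (k i).1 = (k j).1 ↔ i.val / 2 = j.val / 2 := by
    intro i j
    simp [k, Fin.ext_iff]
  refine ⟨fun i => ψ (k i), hψ.comp k.injective, fun i => hψS _, fun i j => ?_⟩
  rw [completeMinusMatching_adj]
  by_cases hij : i = j
  · subst hij
    simp
  · have h1 : k i ≠ k j := fun h => hij (k.injective h)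
    have h2 := hf _ (hψS (k i)) _ (hψS (k j))
    rw [mem_coNeighbors] at h2
    have h3 : ψ (k j) ≠ ψ (k i) := fun h => h1 (hψ h.symm)
    rw [ne_eq, ← hk, ← hfψ _ _ h1]
    constructor
    · intro hadj heq
      exact (h2.2 heq.symm).2 hadj
    · intro hne
      by_contra hadj
      exact hne (h2.1 ⟨h3, hadj⟩).symm

theorem card_coNeighbors_eq_two {V : Type*} [Fintype V] {G : SimpleGraph V} {n : ℕ} (hn : 3 ≤ n)
    (hcard : Fintype.card V = n) {i : V} (h : G.degree i = n - 3) : (coNeighbors G i).card = 2 := by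
  have := card_coNeighbors G i
  omega

theorem coNeighbors_eq_pair {V : Type*} [Fintype V] {G : SimpleGraph V} {i a b : V}
    (h : (coNeighbors G i).card = 2) (hab : a ≠ b) (ha : a ∈ coNeighbors G i)
    (hb : b ∈ coNeighbors G i) : coNeighbors G i = {a, b} := by
  symm
  refine Finset.eq_of_subset_of_card_le ?_ (by rw [h, Finset.card_pair hab])
  intro j hj
  rw [Finset.mem_insert, Finset.mem_singleton] at hj
  rcases hj with rfl | rfl <;> assumption

theorem mem_coNeighbors_comm {V : Type*} [Fintype V] {G : SimpleGraph V} {i j : V} :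
    i ∈ coNeighbors G j ↔ j ∈ coNeighbors G i := by
  rw [mem_coNeighbors, mem_coNeighbors, G.adj_comm, ne_comm]

theorem adj_iff_notMem {V : Type*} [Fintype V] {G : SimpleGraph V} {i j : V} (h : i ≠ j) :
    G.Adj i j ↔ j ∉ coNeighbors G i := by
  rw [mem_coNeighbors]
  have := h.symm
  tauto

theorem iso_of_injective {V W : Type*} [Fintype V] [Fintype W] {G : SimpleGraph V}
    {H : SimpleGraph W} (hcard : Fintype.card V = Fintype.card W) (g : W → V)
    (hg : Function.Injective g) (hadj : ∀ i j, G.Adj (g i) (g j) ↔ H.Adj i j) :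
    Nonempty (G ≃g H) := by
  have hbij := (Fintype.bijective_iff_injective_and_card g).2 ⟨hg, hcard.symm⟩
  exact ⟨(SimpleGraph.Iso.symm ⟨Equiv.ofBijective g hbij, by
    intro i j
    exact hadj i j⟩)⟩

/-- The neighbor v of the pendant vertex a misses two vertices p and q. Each of these misses v and
a, hence nothing else. Every remaining vertex misses a and one other remaining vertex. -/
theorem nonempty_iso_h1 {V : Type*} [Fintype V] {G : SimpleGraph V} {n : ℕ} (hn : 6 ≤ n)
    (hcard : Fintype.card V = n) {a : V} (ha : G.degree a = 1)
    (hfull : ∀ i ≠ a, G.degree i = n - 3) : Nonempty (G ≃g H1 n) := by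
  have htwo : ∀ i ≠ a, (coNeighbors G i).card = 2 := fun i hi =>
    card_coNeighbors_eq_two (by omega) hcard (hfull i hi)
  obtain ⟨v, hv⟩ := Finset.card_eq_one.1 ((G.card_neighborFinset_eq_degree a).trans ha)
  have hav : ∀ i, G.Adj a i ↔ i = v := fun i => by
    rw [← SimpleGraph.mem_neighborFinset, hv, Finset.mem_singleton]
  have hva : v ≠ a := ((hav v).2 rfl).ne'
  have hca : ∀ i, i ≠ a → i ≠ v → a ∈ coNeighbors G i := fun i hia hiv => by
    rw [mem_coNeighbors, G.adj_comm, hav]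
    exact ⟨hia.symm, hiv⟩
  obtain ⟨p, q, hpq, hcv⟩ := Finset.card_eq_two.1 (htwo v hva)
  have hcv' : ∀ i, i ∈ coNeighbors G v ↔ i = p ∨ i = q := fun i => by simp [hcv]
  have hnota : a ∉ coNeighbors G v := by
    rw [mem_coNeighbors, not_and, not_not]
    exact fun _ => ((hav v).2 rfl).symm
  have hcp : ∀ p ∈ coNeighbors G v, p ≠ a ∧ p ≠ v ∧ coNeighbors G p = {a, v} := by
    intro p hp
    have h1 : p ≠ a := by
      rintro rfl
      exact hnota hp
    have h2 := (mem_coNeighbors.1 hp).1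
    exact ⟨h1, h2, coNeighbors_eq_pair (htwo p h1) hva.symm (hca p h1 h2)
      (mem_coNeighbors_comm.1 hp)⟩
  obtain ⟨hpa, hpv, hp⟩ := hcp p (by simp [hcv])
  obtain ⟨hqa, hqv, hq⟩ := hcp q (by simp [hcv])
  set S : Finset V := Finset.univ \ {a, v, p, q} with hSdef
  have hmem : ∀ i, i ∈ S ↔ i ≠ a ∧ i ≠ v ∧ i ≠ p ∧ i ≠ q := by
    intro i
    simp [hSdef]
  have hScard : S.card = n - 4 := by
    rw [hSdef, Finset.card_sdiff_of_subset (Finset.subset_univ _), Finset.card_univ, hcard]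
    congr 1
    rw [Finset.card_insert_of_notMem, Finset.card_insert_of_notMem, Finset.card_pair hpq]
    · simp [hpv.symm, hqv.symm]
    · simp [hva.symm, hpa.symm, hqa.symm]
  obtain ⟨e, he, heS, hadj⟩ := exists_labeling G S hScard (by
    intro x hx
    rw [hmem] at hx
    obtain ⟨hxa, hxv, hxp, hxq⟩ := hx
    obtain ⟨y, hy⟩ : ∃ y, (coNeighbors G x).erase a = {y} := by
      rw [← Finset.card_eq_one, Finset.card_erase_of_mem (hca x hxa hxv), htwo x hxa]
    have hy' : y ∈ (coNeighbors G x).erase a := by simp [hy]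
    rw [Finset.mem_erase] at hy'
    refine ⟨y, ?_, ?_⟩
    · rw [hmem]
      refine ⟨hy'.1, ?_, ?_, ?_⟩
      · rintro rfl
        rw [mem_coNeighbors_comm, hcv'] at hy'
        tauto
      · rintro rfl
        rw [mem_coNeighbors_comm, hp] at hy'
        simp [hxa, hxv] at hy'
      · rintro rfl
        rw [mem_coNeighbors_comm, hq] at hy'
        simp [hxa, hxv] at hy'
    · intro z hz
      rw [hmem] at hz
      have : z ∈ (coNeighbors G x).erase a ↔ z ∈ coNeighbors G x := by
        rw [Finset.mem_erase]
        tauto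
      rw [← this, hy, Finset.mem_singleton])
  have heS' : ∀ i, e i ≠ a ∧ e i ≠ v ∧ e i ≠ p ∧ e i ≠ q := fun i => (hmem _).1 (heS i)
  have ee : ∀ i j, (H1 n).Adj (.V1 i) (.V1 j) ↔ (completeMinusMatching (n - 4)).Adj i j := by
    intro i j
    simp only [H1, SimpleGraph.fromRel_adj, (completeMinusMatching (n - 4)).adj_comm j i, or_self,
      ne_eq, H1Vertex.V1.injEq, and_iff_right_iff_imp]
    exact fun h => h.ne
  have av : G.Adj a v := (hav v).2 rfl
  have ae : ∀ i, ¬ G.Adj a (e i) := fun i h => (heS' i).2.1 ((hav _).1 h)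
  have ap : ¬ G.Adj a p := fun h => hpv ((hav _).1 h)
  have aq : ¬ G.Adj a q := fun h => hqv ((hav _).1 h)
  have ve : ∀ i, G.Adj v (e i) := fun i => by
    rw [adj_iff_notMem (heS' i).2.1.symm, hcv']
    have := heS' i
    tauto
  have vp : ¬ G.Adj v p := (mem_coNeighbors.1 ((hcv' p).2 (Or.inl rfl))).2
  have vq : ¬ G.Adj v q := (mem_coNeighbors.1 ((hcv' q).2 (Or.inr rfl))).2
  have pe : ∀ i, G.Adj p (e i) := fun i => by
    rw [adj_iff_notMem (heS' i).2.2.1.symm, hp]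
    simp [heS' i]
  have qe : ∀ i, G.Adj q (e i) := fun i => by
    rw [adj_iff_notMem (heS' i).2.2.2.symm, hq]
    simp [heS' i]
  have pq : G.Adj p q := by
    rw [adj_iff_notMem hpq, hp]
    simp [hqa, hqv]
  let g : H1Vertex n → V := fun
    | .u => a
    | .v => v
    | .V1 i => e i
    | .V2 i => if i = 0 then p else q
  refine iso_of_injective (hcard.trans (card_h1Vertex (by omega)).symm) g ?_ ?_
  · rintro (_ | _ | i | i) (_ | _ | j | j) hij <;> try fin_cases i
    all_goals try fin_cases j
    all_goals simp [g, hva, hva.symm, heS', (heS' _).1.symm, (heS' _).2.1.symm,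
      (heS' _).2.2.1.symm, (heS' _).2.2.2.symm, he.eq_iff, hpa, hpa.symm, hpv, hpv.symm, hqa,
      hqa.symm, hqv, hqv.symm, hpq, hpq.symm] at hij ⊢
    all_goals assumption
  · rintro (_ | _ | i | i) (_ | _ | j | j)
    case V1.V1 => rw [ee, ← hadj]
    all_goals try fin_cases i
    all_goals try fin_cases j
    all_goals simp [g, H1, av, av.symm, ae, ap, aq, ve, vp, vq, pe, qe, pq, pq.symm,
      G.adj_comm _ a, G.adj_comm _ v, G.adj_comm (e _) p, G.adj_comm (e _) q]

/-- The two vertices missed by v miss exactly a and v, and the two missed by w miss exactly a and w,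
so these four are distinct and mutually adjacent. Each of the other n - 7 vertices misses a and one
of its own kind. -/
theorem nonempty_iso_h2 {V : Type*} [Fintype V] {G : SimpleGraph V} {n : ℕ} (hn : 9 ≤ n)
    (hcard : Fintype.card V = n) {a v w : V} (hvw : v ≠ w) (hN : G.neighborFinset a = {v, w})
    (vw : G.Adj v w) (hfull : ∀ i ≠ a, G.degree i = n - 3) : Nonempty (G ≃g H2 n) := by
  have htwo : ∀ i ≠ a, (coNeighbors G i).card = 2 := fun i hi =>
    card_coNeighbors_eq_two (by omega) hcard (hfull i hi)
  have hav : ∀ i, G.Adj a i ↔ i = v ∨ i = w := fun i => by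
    rw [← SimpleGraph.mem_neighborFinset, hN, Finset.mem_insert, Finset.mem_singleton]
  have av : G.Adj a v := (hav v).2 (Or.inl rfl)
  have aw : G.Adj a w := (hav w).2 (Or.inr rfl)
  have hva := av.ne'
  have hwa := aw.ne'
  have hca : ∀ i, i ≠ a → i ≠ v → i ≠ w → a ∈ coNeighbors G i := fun i hia hiv hiw => by
    rw [mem_coNeighbors, G.adj_comm, hav]
    exact ⟨hia.symm, by tauto⟩
  obtain ⟨p, p', hpp, hcv⟩ := Finset.card_eq_two.1 (htwo v hva)
  obtain ⟨q, q', hqq, hcw⟩ := Finset.card_eq_two.1 (htwo w hwa)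
  have hcv' : ∀ i, i ∈ coNeighbors G v ↔ i = p ∨ i = p' := fun i => by simp [hcv]
  have hcw' : ∀ i, i ∈ coNeighbors G w ↔ i = q ∨ i = q' := fun i => by simp [hcw]
  have hmiss : ∀ {c d : V}, G.Adj a c → G.Adj c d → (∀ i, G.Adj a i → i = c ∨ i = d) →
      ∀ p ∈ coNeighbors G c, p ≠ a ∧ p ≠ c ∧ p ≠ d ∧ coNeighbors G p = {a, c} := by
    intro c d hac hcd hcover p hp
    obtain ⟨h2, h3⟩ := mem_coNeighbors.1 hp
    have h1 : p ≠ a := by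
      rintro rfl
      exact h3 hac.symm
    have h4 : p ≠ d := by
      rintro rfl
      exact h3 hcd
    refine ⟨h1, h2, h4, coNeighbors_eq_pair (htwo p h1) hac.ne ?_ (mem_coNeighbors_comm.1 hp)⟩
    rw [mem_coNeighbors, G.adj_comm]
    exact ⟨h1.symm, fun h => by have := hcover _ h; tauto⟩
  have hmv := hmiss av vw fun i => (hav i).1
  have hmw := hmiss aw vw.symm fun i hi => ((hav i).1 hi).symm
  obtain ⟨hpa, hpv, hpw, hp⟩ := hmv p (by simp [hcv])
  obtain ⟨hpa', hpv', hpw', hp'⟩ := hmv p' (by simp [hcv])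
  obtain ⟨hqa, hqw, hqv, hq⟩ := hmw q (by simp [hcw])
  obtain ⟨hqa', hqw', hqv', hq'⟩ := hmw q' (by simp [hcw])
  have hne : ∀ {p q : V}, coNeighbors G p = {a, v} → coNeighbors G q = {a, w} → p ≠ q := by
    rintro p q hp hq rfl
    have h1 : v ∈ coNeighbors G p := by simp [hp]
    rw [hq] at h1
    simp [hva, hvw] at h1
  have hpq := hne hp hq
  have hpq1 := hne hp hq'
  have hpq2 := hne hp' hq
  have hpq3 := hne hp' hq'
  set S : Finset V := Finset.univ \ {a, v, w, p, p', q, q'} with hSdef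
  have hmem : ∀ i, i ∈ S ↔ i ≠ a ∧ i ≠ v ∧ i ≠ w ∧ i ≠ p ∧ i ≠ p' ∧ i ≠ q ∧ i ≠ q' := by
    intro i
    simp [hSdef]
  have hScard : S.card = n - 7 := by
    rw [hSdef, Finset.card_sdiff_of_subset (Finset.subset_univ _), Finset.card_univ, hcard]
    congr 1
    rw [Finset.card_insert_of_notMem, Finset.card_insert_of_notMem, Finset.card_insert_of_notMem,
      Finset.card_insert_of_notMem, Finset.card_insert_of_notMem, Finset.card_pair hqq]
    · simp [hpq2, hpq3]
    · simp [hpp, hpq, hpq1]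
    · simp [hpw.symm, hpw'.symm, hqw.symm, hqw'.symm]
    · simp [hvw, hpv.symm, hpv'.symm, hqv.symm, hqv'.symm]
    · simp [hva.symm, hwa.symm, hpa.symm, hpa'.symm, hqa.symm, hqa'.symm]
  obtain ⟨e, he, heS, hadj⟩ := exists_labeling G S hScard (by
    intro x hx
    rw [hmem] at hx
    obtain ⟨hxa, hxv, hxw, hxp⟩ := hx
    obtain ⟨y, hy⟩ : ∃ y, (coNeighbors G x).erase a = {y} := by
      rw [← Finset.card_eq_one, Finset.card_erase_of_mem (hca x hxa hxv hxw), htwo x hxa]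
    have hy' : y ∈ (coNeighbors G x).erase a := by simp [hy]
    rw [Finset.mem_erase] at hy'
    refine ⟨y, ?_, ?_⟩
    · rw [hmem]
      refine ⟨hy'.1, ?_, ?_, ?_, ?_, ?_, ?_⟩ <;> rintro rfl
      · rw [mem_coNeighbors_comm, hcv'] at hy'
        tauto
      · rw [mem_coNeighbors_comm, hcw'] at hy'
        tauto
      · rw [mem_coNeighbors_comm, hp] at hy'
        simp [hxa, hxv] at hy'
      · rw [mem_coNeighbors_comm, hp'] at hy'
        simp [hxa, hxv] at hy'
      · rw [mem_coNeighbors_comm, hq] at hy'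
        simp [hxa, hxw] at hy'
      · rw [mem_coNeighbors_comm, hq'] at hy'
        simp [hxa, hxw] at hy'
    · intro z hz
      rw [hmem] at hz
      have : z ∈ (coNeighbors G x).erase a ↔ z ∈ coNeighbors G x := by
        rw [Finset.mem_erase]
        tauto
      rw [← this, hy, Finset.mem_singleton])
  have heS' := fun i => (hmem _).1 (heS i)
  have ee : ∀ i j, (H2 n).Adj (.V3 i) (.V3 j) ↔ (completeMinusMatching (n - 7)).Adj i j := by
    intro i j
    simp only [H2, SimpleGraph.fromRel_adj, (completeMinusMatching (n - 7)).adj_comm j i, or_self,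
      ne_eq, H2Vertex.V3.injEq, and_iff_right_iff_imp]
    exact fun h => h.ne
  have ax : ∀ i, i ≠ v → i ≠ w → ¬ G.Adj a i := fun i h1 h2 h3 => by
    have := (hav i).1 h3
    tauto
  have vx : ∀ i, i ≠ v → (G.Adj v i ↔ ¬ (i = p ∨ i = p')) := fun i h1 => by
    rw [adj_iff_notMem h1.symm, hcv']
  have wx : ∀ i, i ≠ w → (G.Adj w i ↔ ¬ (i = q ∨ i = q')) := fun i h1 => by
    rw [adj_iff_notMem h1.symm, hcw']
  have hx : ∀ {c b : V}, coNeighbors G c = {a, b} → ∀ i, i ≠ c → i ≠ a → i ≠ b → G.Adj c i := by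
    intro c b hc i h1 h2 h3
    rw [adj_iff_notMem h1.symm, hc]
    simp [h2, h3]
  -- The part `V1` is joined to `v1`, so it receives q and q', the vertices missed by w; `V2`
  -- receives those missed by v.
  let g : H2Vertex n → V := fun
    | .u => a
    | .v1 => v
    | .v2 => w
    | .V1 i => if i = 0 then q else q'
    | .V2 i => if i = 0 then p else p'
    | .V3 i => e i
  have hnes : [a, v, w, q, q', p, p'].Nodup := by
    simp [hva.symm, hwa.symm, hvw, hqa.symm, hqa'.symm, hpa.symm, hpa'.symm, hqv.symm, hqv'.symm,
      hpv.symm, hpv'.symm, hqw.symm, hqw'.symm, hpw.symm, hpw'.symm, hqq, hpp, hpq.symm, hpq1.symm,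
      hpq2.symm, hpq3.symm]
  have ap := ax p hpv hpw
  have ap' := ax p' hpv' hpw'
  have aq := ax q hqv hqw
  have aq' := ax q' hqv' hqw'
  have ae := fun i => ax (e i) (heS' i).2.1 (heS' i).2.2.1
  have vp : ¬ G.Adj v p := by simp [vx p hpv]
  have vp' : ¬ G.Adj v p' := by simp [vx p' hpv']
  have vq : G.Adj v q := by simp [vx q hqv, hpq.symm, hpq2.symm]
  have vq' : G.Adj v q' := by simp [vx q' hqv', hpq1.symm, hpq3.symm]
  have ve : ∀ i, G.Adj v (e i) := fun i => by
    rw [vx _ (heS' i).2.1]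
    have := heS' i
    tauto
  have wp : G.Adj w p := by simp [wx p hpw, hpq, hpq1]
  have wp' : G.Adj w p' := by simp [wx p' hpw', hpq2, hpq3]
  have wq : ¬ G.Adj w q := by simp [wx q hqw]
  have wq' : ¬ G.Adj w q' := by simp [wx q' hqw']
  have we : ∀ i, G.Adj w (e i) := fun i => by
    rw [wx _ (heS' i).2.2.1]
    have := heS' i
    tauto
  have pp' := hx hp p' hpp.symm hpa' hpv'
  have pq := hx hp q hpq.symm hqa hqv
  have pq' := hx hp q' hpq1.symm hqa' hqv'
  have p'q := hx hp' q hpq2.symm hqa hqv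
  have p'q' := hx hp' q' hpq3.symm hqa' hqv'
  have qq' := hx hq q' hqq.symm hqa' hqw'
  have pe := fun i => hx hp (e i) (heS' i).2.2.2.1 (heS' i).1 (heS' i).2.1
  have pe' := fun i => hx hp' (e i) (heS' i).2.2.2.2.1 (heS' i).1 (heS' i).2.1
  have qe := fun i => hx hq (e i) (heS' i).2.2.2.2.2.1 (heS' i).1 (heS' i).2.2.1
  have qe' := fun i => hx hq' (e i) (heS' i).2.2.2.2.2.2 (heS' i).1 (heS' i).2.2.1
  refine iso_of_injective (hcard.trans (card_h2Vertex (by omega)).symm) g ?_ ?_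
  · have hlist : ∀ i j : Fin 7, [a, v, w, q, q', p, p'].get i = [a, v, w, q, q', p, p'].get j →
        i = j := fun i j h => hnes.injective_get h
    -- The seven special vertices are indexed by their place in the list `hnes`, so injectivity on
    -- them follows from the list having no repetition; `none` marks `V3`.
    let c : H2Vertex n → Option (Fin 7) := fun
      | .u => some 0
      | .v1 => some 1
      | .v2 => some 2
      | .V1 i => if i = 0 then some 3 else some 4
      | .V2 i => if i = 0 then some 5 else some 6
      | .V3 _ => none
    have hc : ∀ i k, c i = some k → g i = [a, v, w, q, q', p, p'].get k := by
      rintro (_ | _ | _ | i | i | i) k hk <;> try fin_cases i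
      all_goals simp [c] at hk
      all_goals subst hk
      all_goals rfl
    have hc' : ∀ i j k, c i = some k → c j = some k → i = j := by
      rintro (_ | _ | _ | i | i | i) (_ | _ | _ | j | j | j) k hi hj <;> try fin_cases i
      all_goals try fin_cases j
      all_goals simp [c] at hi hj ⊢
      all_goals subst hi
      all_goals simp at hj
    have hg3 : ∀ i k, g (.V3 i) ≠ [a, v, w, q, q', p, p'].get k := by
      intro i k h
      have := heS' i
      fin_cases k <;> simp [g] at h <;> tauto
    intro i j hij
    rcases hci : c i with _ | k <;> rcases hcj : c j with _ | l
    · obtain ⟨i, rfl⟩ : ∃ i', i = .V3 i' := by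
        rcases i with _ | _ | _ | i | i | i <;> try fin_cases i
        all_goals simp [c] at hci ⊢
      obtain ⟨j, rfl⟩ : ∃ j', j = .V3 j' := by
        rcases j with _ | _ | _ | j | j | j <;> try fin_cases j
        all_goals simp [c] at hcj ⊢
      rw [he hij]
    · obtain ⟨i, rfl⟩ : ∃ i', i = .V3 i' := by
        rcases i with _ | _ | _ | i | i | i <;> try fin_cases i
        all_goals simp [c] at hci ⊢
      exact (hg3 i l (hij.trans (hc j l hcj))).elim
    · obtain ⟨j, rfl⟩ : ∃ j', j = .V3 j' := by
        rcases j with _ | _ | _ | j | j | j <;> try fin_cases j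
        all_goals simp [c] at hcj ⊢
      exact (hg3 j k (hij.symm.trans (hc i k hci))).elim
    · have := hlist k l (by rw [← hc i k hci, ← hc j l hcj, hij])
      subst this
      exact hc' i j k hci hcj
  · rintro (_ | _ | _ | i | i | i) (_ | _ | _ | j | j | j)
    case V3.V3 => rw [ee, ← hadj]
    all_goals try fin_cases i
    all_goals try fin_cases j
    all_goals simp [g, H2, av, aw, vw, ap, ap', aq, aq', ae, vp, vp', vq, vq', ve, wp, wp', wq, wq',
      we, pp', pq, pq', p'q, p'q', qq', pe, pe', qe, qe', av.symm, aw.symm, vw.symm, pp'.symm,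
      pq.symm, pq'.symm, p'q.symm, p'q'.symm, qq'.symm, G.adj_comm _ a, G.adj_comm _ v,
      G.adj_comm _ w, G.adj_comm (e _) p, G.adj_comm (e _) p', G.adj_comm (e _) q,
      G.adj_comm (e _) q']

end Labeling

/-! ### Invariance under isomorphism and the extremal graphs -/

section Main
open Classical

theorem degree_congr {V W : Type*} [Fintype V] [Fintype W] {G : SimpleGraph V}
    {H : SimpleGraph W} (e : G ≃g H) (i : V) : H.degree (e i) = G.degree i := by
  rw [degree_eq_sum, degree_eq_sum, ← e.toEquiv.sum_comp]
  refine Finset.sum_congr rfl fun j _ => ?_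
  have : H.Adj (e i) (e j) ↔ G.Adj i j := e.map_adj_iff
  exact if_congr this rfl rfl

theorem IsConnectedNonregular.congr {V W : Type*} [Fintype V] [Fintype W] {G : SimpleGraph V}
    {H : SimpleGraph W} {n d : ℕ} (e : G ≃g H) (h : IsConnectedNonregular n d G) :
    IsConnectedNonregular n d H := by
  refine ⟨(Fintype.card_congr e.toEquiv).symm.trans h.order, e.connected_iff.1 h.connected, ?_, ?_⟩
  · rintro ⟨k, hk⟩
    refine h.nonregular ⟨k, fun i => ?_⟩
    rw [← degree_congr e]
    convert hk (e i)
  · have := h.connected.nonempty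
    refine le_antisymm (H.maxDegree_le_of_forall_degree_le _ fun j => ?_) ?_
    · rw [← e.apply_symm_apply j, degree_congr, ← h.maxDegree]
      exact G.degree_le_maxDegree _
    · obtain ⟨i, hi⟩ := G.exists_maximal_degree_vertex
      rw [← h.maxDegree, hi, ← degree_congr e]
      exact H.degree_le_maxDegree _

/-- If every competitor that is at least as good as `H` is isomorphic to `H`, then the extremal
graphs are exactly the copies of `H`. -/
theorem isExtremal_iff_of_unique {W : Type*} [Fintype W] {H : SimpleGraph W} {n d : ℕ}
    (hH : IsConnectedNonregular n d H)
    (huniq : ∀ G : SimpleGraph (Fin n), IsConnectedNonregular n d G →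
      graphSpectralRadius H ≤ graphSpectralRadius G → Nonempty (G ≃g H))
    {V : Type*} [Fintype V] (G : SimpleGraph V) : IsExtremal n d G ↔ Nonempty (G ≃g H) := by
  constructor
  · intro hG
    let e := SimpleGraph.Iso.map (Fintype.equivFinOfCardEq hG.mem.order) G
    let e' := SimpleGraph.Iso.map (Fintype.equivFinOfCardEq hH.order) H
    have h1 := hG.max _ (hH.congr e')
    rw [← graphSpectralRadius_congr e', graphSpectralRadius_congr e] at h1
    obtain ⟨e''⟩ := huniq _ (hG.mem.congr e) h1
    exact ⟨e.trans e''⟩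
  · rintro ⟨e⟩
    refine ⟨hH.congr e.symm, fun K hK => ?_⟩
    rw [graphSpectralRadius_congr e]
    rcases le_total (graphSpectralRadius K) (graphSpectralRadius H) with h | h
    · exact h
    · obtain ⟨e'⟩ := huniq K hK h
      exact (graphSpectralRadius_congr e').le

theorem isExtremal_iff_h1 {n : ℕ} (hn : 59 ≤ n) (he : Even n) {V : Type*} [Fintype V]
    (G : SimpleGraph V) : IsExtremal n (n - 3) G ↔ Nonempty (G ≃g H1 n) := by
  refine isExtremal_iff_of_unique (h1_isConnectedNonregular he (by omega)) (fun K hK hle => ?_) G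
  obtain ⟨a, ha, hfull⟩ := exists_pendant_of_even hn he hK
    ((h1_spectralRadius_ge he (by omega)).trans hle)
  exact nonempty_iso_h1 (by omega) hK.order ha hfull

theorem isExtremal_iff_h2 {n : ℕ} (hn : 59 ≤ n) (ho : Odd n) {V : Type*} [Fintype V]
    (G : SimpleGraph V) : IsExtremal n (n - 3) G ↔ Nonempty (G ≃g H2 n) := by
  refine isExtremal_iff_of_unique (h2_isConnectedNonregular ho (by omega)) (fun K hK hle => ?_) G
  obtain ⟨a, v, w, hvw, hN, hadj, hfull⟩ := exists_triangle_of_odd hn ho hK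
    ((h2_spectralRadius_ge ho (by omega)).trans hle)
  exact nonempty_iso_h2 (by omega) hK.order hvw hN hadj hfull

theorem degreeSeq_eq {V : Type*} [Fintype V] {G : SimpleGraph V} {n d k : ℕ}
    (hcard : Fintype.card V = n) {a : V} (ha : G.degree a = d)
    (hfull : ∀ i ≠ a, G.degree i = k) : degreeSeq G = d ::ₘ Multiset.replicate (n - 1) k := by
  have h1 : (Finset.univ : Finset V) = Finset.cons a (Finset.univ.erase a) (by simp) := by
    rw [Finset.cons_eq_insert, Finset.insert_erase (Finset.mem_univ a)]
  unfold degreeSeq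
  rw [h1, Finset.cons_val, Multiset.map_cons, ha]
  congr 1
  rw [Multiset.eq_replicate]
  constructor
  · rw [Multiset.card_map, Finset.card_val, Finset.card_erase_of_mem (Finset.mem_univ a),
      Finset.card_univ, hcard]
  · intro b hb
    rw [Multiset.mem_map] at hb
    obtain ⟨i, hi, rfl⟩ := hb
    exact hfull i (Finset.ne_of_mem_erase hi)

theorem degreeSeq_of_iso {V W : Type*} [Fintype V] [Fintype W] {G : SimpleGraph V}
    {H : SimpleGraph W} {n d k : ℕ} (e : G ≃g H) (hcard : Fintype.card W = n) {a : W}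
    (ha : H.degree a = d) (hfull : ∀ i ≠ a, H.degree i = k) :
    degreeSeq G = d ::ₘ Multiset.replicate (n - 1) k := by
  refine degreeSeq_eq ((Fintype.card_congr e.toEquiv).trans hcard) (a := e.symm a) ?_ ?_
  · rw [degree_congr e.symm, ha]
  · intro i hi
    rw [← degree_congr e]
    exact hfull _ fun h => hi (by rw [← h, e.symm_apply_apply])

end Main

theorem theorem2 (n : ℕ) (hn : 59 ≤ n) :
    -- the extremal graphs are exactly the copies of `H₁(n)` (even `n`) or `H₂(n)` (odd `n`)
    (∀ {V : Type*} [Fintype V] (G : SimpleGraph V),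
      (Even n → (IsExtremal n (n - 3) G ↔ Nonempty (G ≃g H1 n))) ∧
      (Odd n → (IsExtremal n (n - 3) G ↔ Nonempty (G ≃g H2 n)))) ∧
    -- there is an extremal graph, and it is unique up to isomorphism
    (∃ G : SimpleGraph (Fin n), IsExtremal n (n - 3) G) ∧
    (∀ {V W : Type*} [Fintype V] [Fintype W] (G : SimpleGraph V) (G' : SimpleGraph W),
      IsExtremal n (n - 3) G → IsExtremal n (n - 3) G' → Nonempty (G ≃g G')) ∧
    -- its degree sequence is `(Δ, …, Δ, δ)`
    (∀ {V : Type*} [Fintype V] (G : SimpleGraph V), IsExtremal n (n - 3) G →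
      degreeSeq G = (if Even n then 1 else 2) ::ₘ Multiset.replicate (n - 1) (n - 3)) := by

  have hodd : ¬ Even n → Odd n := Nat.not_even_iff_odd.1
  refine ⟨fun G => ⟨fun he => isExtremal_iff_h1 hn he G, fun ho => isExtremal_iff_h2 hn ho G⟩,
    ?_, ?_, ?_⟩
  · by_cases he : Even n
    · let f := Fintype.equivFinOfCardEq (card_h1Vertex (n := n) (by omega))
      exact ⟨_, (isExtremal_iff_h1 hn he _).2 ⟨(SimpleGraph.Iso.map f (H1 n)).symm⟩⟩
    · let f := Fintype.equivFinOfCardEq (card_h2Vertex (n := n) (by omega))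
      exact ⟨_, (isExtremal_iff_h2 hn (hodd he) _).2 ⟨(SimpleGraph.Iso.map f (H2 n)).symm⟩⟩
  · intro V W _ _ G G' hG hG'
    by_cases he : Even n
    · obtain ⟨e⟩ := (isExtremal_iff_h1 hn he G).1 hG
      obtain ⟨e'⟩ := (isExtremal_iff_h1 hn he G').1 hG'
      exact ⟨e.trans e'.symm⟩
    · obtain ⟨e⟩ := (isExtremal_iff_h2 hn (hodd he) G).1 hG
      obtain ⟨e'⟩ := (isExtremal_iff_h2 hn (hodd he) G').1 hG'
      exact ⟨e.trans e'.symm⟩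
  · intro V _ G hG
    by_cases he : Even n
    · obtain ⟨e⟩ := (isExtremal_iff_h1 hn he G).1 hG
      obtain ⟨h1, h2⟩ := h1_degree he (by omega)
      rw [if_pos he]
      exact degreeSeq_of_iso e (card_h1Vertex (by omega)) h1 h2
    · obtain ⟨e⟩ := (isExtremal_iff_h2 hn (hodd he) G).1 hG
      obtain ⟨h1, h2⟩ := h2_degree (hodd he) (by omega)
      rw [if_neg he]
      exact degreeSeq_of_iso e (card_h2Vertex (by omega)) h1 h2
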